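/- Let $G$ be a finite-dimensional real Lie group with Lie algebra $\mathfrak g$, let $H$ be a Lie subgroup of $G$ with Lie algebra $\mathfrak h$, and suppose that $\mathfrak g=\bigoplus_{i\in\mathbb Z}\mathfrak g_i$ is a graded Lie algebra ($[\mathfrak g_i,\mathfrak g_j]\subset\mathfrak g_{i+j}$) with $\mathfrak h=\bigoplus_{i\ge 0}\mathfrak g_i$. Put $\mathfrak g_-=\bigoplus_{i<0}\mathfrak g_i$. Let $P\to M$ be a smooth principal $H$-bundle with a Cartan connection $\omega$ of type $(G,H)$, i.e. a smooth $\mathfrak g$-valued $1$-form on $P$ such that each $\omega_p:T_pP\to\mathfrak g$ is an isomorphism, $R_h^*\omega=\mathrm{Ad}(h^{-1})\omega$ for $h\in H$, and $\omega(\zeta_A)=A$ for the fundamental vector field $\zeta_A$ of each $A\in\mathfrak h$. Let $\Omega=d\omega+\frac12[\omega,\omega]$ be its curvature and $$C:P\to \mathrm{Hom}(\wedge^2\mathfrak g_-,\mathfrak g),\qquad C(p)(x,y)=\Omega_p\big(\omega_p^{-1}(x),\omega_p^{-1}(y)\big)$$ its structure function. An element $\varphi\in\mathrm{Hom}(\wedge^2\mathfrak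 g_-,\mathfrak g)$ is homogeneous of degree $k$ if $\varphi(\mathfrak g_i,\mathfrak g_j)\subset\mathfrak g_{i+j+k}$ for all $i,j<0$. Let $\partial:\mathrm{Hom}(\wedge^2\mathfrak g_-,\mathfrak g)\to\mathrm{Hom}(\wedge^3\mathfrak g_-,\mathfrak g)$ be the differential of Lie algebra cohomology of $\mathfrak g_-$ with values in $\mathfrak g$ (with the adjoint action). For a function $f:P\to V$ with values in a finite-dimensional real vector space, let $L(f)$ be the algebra of functions on $P$ generated by the functions $\langle f,v^*\rangle$, $v^*\in V^*$, and all their iterated covariant derivatives, where the covariant derivative of a function $g$ along $X\in\mathfrak g$ is the derivative of $g$ along the vector field $\omega^{-1}(X)$. One says that $f$ is a fundamental system of differential invariants if $L(f)=L(C)$. Let $W\subset\mathrm{Hom}(\wedge^2\mathfrak g_-,\mathfrak g)$ be a graded subspace (the sum of its homogeneous parts). Assume that $C$ takes values in $W$ and has only components of positive degree. Let $\pi:W\to \ker\partial\cap W$ be any degree-preserving linear projection of $W$ onto $\ker\partial\cap W$. Then the $\ker\partial\cap W$ part $\pi\circ C$ of the structure function is a fundamental system of differential invariants: $L(\pi\circ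 C)=L(C)$. -/

import Mathlib

open scoped Manifold ContDiff Topology
open LieModule.Cohomology

set_option maxSynthPendingDepth 3

noncomputable section

namespace CartanGeometry

instance minSmoothness_three_le : ENat.LEInfty (minSmoothness ℝ 3) where
  out := by
    rw [minSmoothness_of_isRCLikeNormedField]
    exact ENat.LEInfty.out

/-! ### Graded Lie algebras and the complex `Hom(⋀ 𝔤₋, 𝔤)` -/

section Graded

variable {L : Type*} [LieRing L] [LieAlgebra ℝ L]

/-- The negative part `𝔤₋ = ⨁_{i < 0} 𝔤_i` of a `ℤ`-graded Lie algebra, as a subalgebra. -/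
def negPart (𝒢 : ℤ → Submodule ℝ L) [GradedLieAlgebra 𝒢] : LieSubalgebra ℝ L where
  toSubmodule := ⨆ i : {i : ℤ // i < 0}, 𝒢 i
  lie_mem' := by
    intro x y hx hy
    change x ∈ ⨆ i : {i : ℤ // i < 0}, 𝒢 i at hx
    change y ∈ ⨆ i : {i : ℤ // i < 0}, 𝒢 i at hy
    change ⁅x, y⁆ ∈ ⨆ i : {i : ℤ // i < 0}, 𝒢 i
    induction hx using Submodule.iSup_induction' with
    | zero => simp
    | add a b _ _ ha hb => rw [add_lie]; exact add_mem ha hb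
    | mem i a ha =>
      induction hy using Submodule.iSup_induction' with
      | zero => simp
      | add c d _ _ hc hd => rw [lie_add]; exact add_mem hc hd
      | mem j c hc =>
        exact Submodule.mem_iSup_of_mem (p := fun i : {i : ℤ // i < 0} => 𝒢 i)
          ⟨i.1 + j.1, add_neg i.2 j.2⟩ (SetLike.GradedBracket.bracket_mem ha hc)

/-- `Hom(⋀² 𝔤₋, 𝔤)`: alternating bilinear maps `𝔤₋ × 𝔤₋ → 𝔤`. -/
abbrev Cochain₂ (𝒢 : ℤ → Submodule ℝ L) [GradedLieAlgebra 𝒢] :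
    Submodule ℝ (negPart 𝒢 →ₗ[ℝ] negPart 𝒢 →ₗ[ℝ] L) :=
  twoCochain ℝ (negPart 𝒢) L

/-- The homogeneous component of degree `k` of `Hom(⋀² 𝔤₋, 𝔤)`: the maps `φ` with
`φ(𝔤_i, 𝔤_j) ⊆ 𝔤_{i+j+k}`. -/
def homogeneous (𝒢 : ℤ → Submodule ℝ L) [GradedLieAlgebra 𝒢] (k : ℤ) :
    Submodule ℝ (Cochain₂ 𝒢) where
  carrier := {φ | ∀ (i j : ℤ) (x y : negPart 𝒢), (x : L) ∈ 𝒢 i → (y : L) ∈ 𝒢 j →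
    φ x y ∈ 𝒢 (i + j + k)}
  add_mem' := fun ha hb i j x y hx hy => add_mem (ha i j x y hx hy) (hb i j x y hx hy)
  zero_mem' := fun i j _ _ _ _ => zero_mem (𝒢 (i + j + k))
  smul_mem' := fun c _ ha i j x y hx hy => Submodule.smul_mem _ c (ha i j x y hx hy)

/-- The kernel of the Lie algebra cohomology differential
`∂ : Hom(⋀² 𝔤₋, 𝔤) → Hom(⋀³ 𝔤₋, 𝔤)`, where `𝔤₋` acts on `𝔤` by the adjoint action. -/
abbrev kerDifferential (𝒢 : ℤ → Submodule ℝ L) [GradedLieAlgebra 𝒢] :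
    Submodule ℝ (Cochain₂ 𝒢) :=
  LinearMap.ker (d₂₃ ℝ (negPart 𝒢) L)

end Graded

/-! ### Lie groups and principal bundles -/

section Bundles

variable {EG EH EM EP : Type*}
  [NormedAddCommGroup EG] [NormedSpace ℝ EG]
  [NormedAddCommGroup EH] [NormedSpace ℝ EH]
  [NormedAddCommGroup EM] [NormedSpace ℝ EM]
  [NormedAddCommGroup EP] [NormedSpace ℝ EP]
  {G H M P : Type*}
  [Group G] [TopologicalSpace G] [ChartedSpace EG G]
  [Group H] [TopologicalSpace H] [ChartedSpace EH H]
  [TopologicalSpace M] [ChartedSpace EM M]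
  [TopologicalSpace P] [ChartedSpace EP P]

variable (EG G) in
/-- The underlying normed space of the Lie algebra `𝔤 = T₁G`. -/
def lieToModel : GroupLieAlgebra 𝓘(ℝ, EG) G ≃L[ℝ] EG where
  toFun v := v
  invFun v := v
  map_add' _ _ := rfl
  map_smul' _ _ := rfl
  left_inv _ := rfl
  right_inv _ := rfl
  continuous_toFun := continuous_id
  continuous_invFun := continuous_id

/-- The differential at the identity of a homomorphism of Lie groups. -/
def lieMap (ι : H →* G) :
    GroupLieAlgebra 𝓘(ℝ, EH) H →L[ℝ] GroupLieAlgebra 𝓘(ℝ, EG) G :=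
  (lieToModel EG G).symm.toContinuousLinearMap.comp
    (mfderiv 𝓘(ℝ, EH) 𝓘(ℝ, EG) ι (1 : H) : TangentSpace 𝓘(ℝ, EH) (1 : H) →L[ℝ] EG)

/-- The adjoint representation: `Ad g` is the differential at `1` of `x ↦ g x g⁻¹`. -/
def Ad (g : G) : GroupLieAlgebra 𝓘(ℝ, EG) G →L[ℝ] GroupLieAlgebra 𝓘(ℝ, EG) G :=
  (lieToModel EG G).symm.toContinuousLinearMap.comp
    (mfderiv 𝓘(ℝ, EG) 𝓘(ℝ, EG) (fun x : G => g * x * g⁻¹) (1 : G) :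
      TangentSpace 𝓘(ℝ, EG) (1 : G) →L[ℝ] EG)

/-- `ι` exhibits the Lie group `H` as a (possibly only immersed) Lie subgroup of `G`. -/
structure IsLieSubgroup (EG EH : Type*)
    [NormedAddCommGroup EG] [NormedSpace ℝ EG] [NormedAddCommGroup EH] [NormedSpace ℝ EH]
    {G H : Type*} [Group G] [TopologicalSpace G] [ChartedSpace EG G]
    [Group H] [TopologicalSpace H] [ChartedSpace EH H] (ι : H →* G) : Prop where
  contMDiff : ContMDiff 𝓘(ℝ, EH) 𝓘(ℝ, EG) ∞ ι
  injective : Function.Injective ι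
  injective_lieMap : Function.Injective (lieMap (EG := EG) (EH := EH) ι)

/-- A smooth principal `H`-bundle `proj : P → M`, with right action `act`. -/
structure PrincipalBundle (EH EM EP : Type*)
    [NormedAddCommGroup EH] [NormedSpace ℝ EH]
    [NormedAddCommGroup EM] [NormedSpace ℝ EM]
    [NormedAddCommGroup EP] [NormedSpace ℝ EP]
    (H M P : Type*) [Group H] [TopologicalSpace H] [ChartedSpace EH H]
    [TopologicalSpace M] [ChartedSpace EM M] [TopologicalSpace P] [ChartedSpace EP P] where
  proj : P → M
  act : P → H → P
  contMDiff_proj : ContMDiff 𝓘(ℝ, EP) 𝓘(ℝ, EM) ∞ proj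
  contMDiff_act : ContMDiff (𝓘(ℝ, EP).prod 𝓘(ℝ, EH)) 𝓘(ℝ, EP) ∞
    (fun x : P × H => act x.1 x.2)
  act_one : ∀ p, act p 1 = p
  act_mul : ∀ p h k, act p (h * k) = act (act p h) k
  proj_act : ∀ p h, proj (act p h) = proj p
  /-- Around each point of `M` there is an `H`-equivariant diffeomorphism
  `proj⁻¹(U) ≃ U × H` over `U`. -/
  locallyTrivial : ∀ x : M, ∃ (U : Set M) (e : OpenPartialHomeomorph P (M × H)),
    IsOpen U ∧ x ∈ U ∧ e.source = proj ⁻¹' U ∧ e.target = U ×ˢ Set.univ ∧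
    ContMDiffOn 𝓘(ℝ, EP) (𝓘(ℝ, EM).prod 𝓘(ℝ, EH)) ∞ e e.source ∧
    ContMDiffOn (𝓘(ℝ, EM).prod 𝓘(ℝ, EH)) 𝓘(ℝ, EP) ∞ e.symm e.target ∧
    ∀ p ∈ e.source, (e p).1 = proj p ∧ ∀ h : H, e (act p h) = ((e p).1, (e p).2 * h)

/-- A Cartan connection of type `(G, H)` on the principal `H`-bundle `B`, where `ι : H → G` is the
inclusion: a smooth `𝔤`-valued `1`-form on `P` which is an isomorphism on each tangent space,
satisfies `(R_h)^* ω = Ad(h⁻¹) ω`, and sends the fundamental vector field of each `A ∈ 𝔥` to `A`. -/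
structure CartanConnection [IsManifold 𝓘(ℝ, EP) ∞ P]
    (ι : H →* G) (B : PrincipalBundle EH EM EP H M P) where
  form : ∀ p : P, TangentSpace 𝓘(ℝ, EP) p →L[ℝ] GroupLieAlgebra 𝓘(ℝ, EG) G
  contMDiff_form : ContMDiff (𝓘(ℝ, EP)).tangent 𝓘(ℝ, EG) ∞
    (fun v : TangentBundle 𝓘(ℝ, EP) P => lieToModel EG G (form v.proj v.snd))
  bijective : ∀ p, Function.Bijective (form p)
  equivariant : ∀ (h : H) (p : P) (v : TangentSpace 𝓘(ℝ, EP) p),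
    form (B.act p h) (mfderiv 𝓘(ℝ, EP) 𝓘(ℝ, EP) (fun q => B.act q h) p v) =
      Ad (ι h⁻¹) (form p v)
  fundamental : ∀ (p : P) (A : GroupLieAlgebra 𝓘(ℝ, EH) H),
    form (B.act p 1) (mfderiv 𝓘(ℝ, EH) 𝓘(ℝ, EP) (fun h => B.act p h) 1 A) = lieMap ι A

/-- The exterior derivative at `p` of an `F`-valued `1`-form `α` on `P`: the exterior derivative of
the local representative of `α` in the chart at `p`, pulled back to `T_p P`. With the
normalization `dα(X, Y) = X(α Y) - Y(α X) - α[X, Y]`. -/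
def extDerivOneForm {F : Type*} [NormedAddCommGroup F] [NormedSpace ℝ F]
    (α : ∀ p : P, TangentSpace 𝓘(ℝ, EP) p →L[ℝ] F) (p : P) :
    TangentSpace 𝓘(ℝ, EP) p [⋀^Fin 2]→L[ℝ] F :=
  (extDeriv (fun y : EP => ContinuousAlternatingMap.ofSubsingleton ℝ EP F (0 : Fin 1)
      ((α ((extChartAt 𝓘(ℝ, EP) p).symm y)).comp
        (mfderiv 𝓘(ℝ, EP) 𝓘(ℝ, EP) (extChartAt 𝓘(ℝ, EP) p).symm y)))
    (extChartAt 𝓘(ℝ, EP) p p)).compContinuousLinearMap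
      (mfderiv 𝓘(ℝ, EP) 𝓘(ℝ, EP) (extChartAt 𝓘(ℝ, EP) p) p)

/-! ### Curvature, structure function, differential invariants -/

namespace CartanConnection

variable [IsManifold 𝓘(ℝ, EP) ∞ P] {ι : H →* G} {B : PrincipalBundle EH EM EP H M P}

/-- `θ_p⁻¹ : 𝔤 → T_p P`. -/
def inv (θ : CartanConnection (EG := EG) ι B) (p : P) :
    GroupLieAlgebra 𝓘(ℝ, EG) G →ₗ[ℝ] TangentSpace 𝓘(ℝ, EP) p :=
  (LinearEquiv.ofBijective (θ.form p : TangentSpace 𝓘(ℝ, EP) p →ₗ[ℝ] _)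
    (θ.bijective p)).symm.toLinearMap

/-- The curvature `Ω = dθ + ½[θ, θ]`, i.e. `Ω(v, w) = dθ(v, w) + [θ(v), θ(w)]`. -/
def curvature (θ : CartanConnection (EG := EG) ι B) (p : P) (v w : TangentSpace 𝓘(ℝ, EP) p) :
    GroupLieAlgebra 𝓘(ℝ, EG) G :=
  (lieToModel EG G).symm (extDerivOneForm
      (fun q => (lieToModel EG G).toContinuousLinearMap.comp (θ.form q)) p ![v, w]) +
    ⁅θ.form p v, θ.form p w⁆

/-- The covariant derivative `θ⁻¹(X) f` of a function `f` on `P` along `X ∈ 𝔤`. -/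
def covDeriv (θ : CartanConnection (EG := EG) ι B) (X : GroupLieAlgebra 𝓘(ℝ, EG) G)
    (f : P → ℝ) : P → ℝ :=
  fun p => mfderiv 𝓘(ℝ, EP) 𝓘(ℝ, ℝ) f p (θ.inv p X)

/-- The functions `⟨f, v*⟩`, `v* ∈ V*`, together with all their iterated covariant derivatives. -/
inductive IsDerivedCoefficient (θ : CartanConnection (EG := EG) ι B)
    {V : Type*} [AddCommGroup V] [Module ℝ V] (f : P → V) : (P → ℝ) → Prop
  | coefficient (v : Module.Dual ℝ V) : IsDerivedCoefficient θ f (fun p => v (f p))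
  | covDeriv (X : GroupLieAlgebra 𝓘(ℝ, EG) G) (g : P → ℝ) :
      IsDerivedCoefficient θ f g → IsDerivedCoefficient θ f (θ.covDeriv X g)

/-- The algebra `L(f)` generated by the functions `⟨f, v*⟩` and all their covariant derivatives. -/
def invariantAlgebra (θ : CartanConnection (EG := EG) ι B)
    {V : Type*} [AddCommGroup V] [Module ℝ V] (f : P → V) : Subalgebra ℝ (P → ℝ) :=
  Algebra.adjoin ℝ {g | θ.IsDerivedCoefficient f g}

variable [CompleteSpace EG] [LieGroup 𝓘(ℝ, EG) ∞ G]

section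

variable (θ : CartanConnection (EG := EG) ι B) (p : P)

theorem curvature_self (v : TangentSpace 𝓘(ℝ, EP) p) : θ.curvature p v v = 0 := by
  have h : extDerivOneForm
      (fun q => (lieToModel EG G).toContinuousLinearMap.comp (θ.form q)) p ![v, v] = 0 :=
    ContinuousAlternatingMap.map_eq_zero_of_eq _ ![v, v] (i := 0) (j := 1) rfl (by decide)
  simp [curvature, h]

theorem curvature_add_left (v v' w : TangentSpace 𝓘(ℝ, EP) p) :
    θ.curvature p (v + v') w = θ.curvature p v w + θ.curvature p v' w := by
  simp only [curvature, ContinuousAlternatingMap.vecCons_add, map_add, add_lie]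
  abel

theorem curvature_smul_left (c : ℝ) (v w : TangentSpace 𝓘(ℝ, EP) p) :
    θ.curvature p (c • v) w = c • θ.curvature p v w := by
  simp only [curvature, ContinuousAlternatingMap.vecCons_smul, map_smul, smul_lie, smul_add]

theorem curvature_swap (v w : TangentSpace 𝓘(ℝ, EP) p) :
    θ.curvature p v w = -θ.curvature p w v := by
  have h : extDerivOneForm
      (fun q => (lieToModel EG G).toContinuousLinearMap.comp (θ.form q)) p ![v, w] =
      -extDerivOneForm
        (fun q => (lieToModel EG G).toContinuousLinearMap.comp (θ.form q)) p ![w, v] := by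
    have := (extDerivOneForm (fun q => (lieToModel EG G).toContinuousLinearMap.comp (θ.form q))
      p).toAlternatingMap.map_swap ![w, v] (i := 0) (j := 1) (by decide)
    have hs : (![w, v] : Fin 2 → TangentSpace 𝓘(ℝ, EP) p) ∘ Equiv.swap 0 1 = ![v, w] := by
      ext i; fin_cases i <;> rfl
    rw [hs] at this
    exact this
  rw [curvature, curvature, h, map_neg, ← lie_skew, neg_add]

theorem curvature_add_right (v w w' : TangentSpace 𝓘(ℝ, EP) p) :
    θ.curvature p v (w + w') = θ.curvature p v w + θ.curvature p v w' := by
  rw [curvature_swap, curvature_add_left, curvature_swap θ p v w, curvature_swap θ p v w', neg_add]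

theorem curvature_smul_right (c : ℝ) (v w : TangentSpace 𝓘(ℝ, EP) p) :
    θ.curvature p v (c • w) = c • θ.curvature p v w := by
  rw [curvature_swap, curvature_smul_left, curvature_swap θ p v w, smul_neg]

end

/-- The structure function `C : P → Hom(⋀² 𝔤₋, 𝔤)`,
`C(p)(x, y) = Ω_p(θ_p⁻¹(x), θ_p⁻¹(y))`. -/
def structureFunction (θ : CartanConnection (EG := EG) ι B)
    (𝒢 : ℤ → Submodule ℝ (GroupLieAlgebra 𝓘(ℝ, EG) G)) [GradedLieAlgebra 𝒢] (p : P) :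
    Cochain₂ 𝒢 :=
  ⟨LinearMap.mk₂ ℝ (fun x y : negPart 𝒢 => θ.curvature p (θ.inv p x) (θ.inv p y))
    (fun x x' y => by simp [curvature_add_left]) (fun c x y => by simp [curvature_smul_left])
    (fun x y y' => by simp [curvature_add_right]) (fun c x y => by simp [curvature_smul_right]),
    fun x => curvature_self θ p _⟩

/-- `f` is a fundamental system of differential invariants: `L(f) = L(C)`. -/
def IsFundamentalSystem (θ : CartanConnection (EG := EG) ι B)
    (𝒢 : ℤ → Submodule ℝ (GroupLieAlgebra 𝓘(ℝ, EG) G)) [GradedLieAlgebra 𝒢]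
    {V : Type*} [AddCommGroup V] [Module ℝ V] (f : P → V) : Prop :=
  θ.invariantAlgebra f = θ.invariantAlgebra (θ.structureFunction 𝒢)

end CartanConnection

end Bundles

end CartanGeometry

end

/-! Write `K p X Y` for the curvature evaluated on the constant fields `ω⁻¹(X)`, `ω⁻¹(Y)`, and `D_X`
for the derivative along `ω⁻¹(X)`. Since `ω` is constant on these fields, the definition of the
curvature becomes `[ω⁻¹X, ω⁻¹Y] = ω⁻¹([X,Y] - K(X,Y))` (`curvature_inv`). The Jacobi identity for
three constant fields is then the Bianchi identity (`bianchi`). On `𝔤₋` it expresses `∂C` as the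
cyclic sum of `K(x, K(y,z))` minus the cyclic sum of `D_x K(y,z)`.

Compare components of homogeneous degree `n`. As `x` has negative degree, `D_x K(y,z)` contributes
only components of `K` of degree below `n`. In `K(x, K(y,z))` the degrees of the two factors add up
to `n`. Only positive degrees occur, so both are below `n`. Here `K` must also be controlled on
arguments of nonnegative degree, where it vanishes because the curvature is horizontal
(`curvature_inv_lieMap`). By induction on `n`, the coefficients of `∂C_n` lie in `L(π ∘ C)`. So do
those of `π C_n`, because `π` preserves degrees. Finally `φ - π φ` depends linearly on `∂φ` for `φ ∈
W`, since `π` is the identity on `ker ∂ ∩ W`; hence `C_n` is recovered from `∂C_n` and `π C_n`. This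
is `dual_comp_mem_of_bianchi`, an argument purely about graded Lie algebras.

Horizontality comes from differentiating the equivariance of `ω`: right translation permutes the
constant fields through `Ad`, which gives `[ζ_A, ω⁻¹X] = ω⁻¹([A,X])` for `A ∈ 𝔥`.

The induction uses that `L(f)` is stable under all `D_X`. This follows from the Leibniz rule once
the functions involved are known to be smooth (`covDeriv_mem_invariantAlgebra`). The inclusion `L(π
∘ C) ⊆ L(C)` is immediate, as `π` is linear. -/

noncomputable section

namespace CartanGeometry

/-! ### Graded linear algebra and the induction on homogeneous degree. -/

section Algebra

open Module

/-- If a family of functionals separates the points of a finite-dimensional space, then membership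
of the corresponding coefficients of a vector-valued function in a space of scalar functions
implies membership of all coefficients. -/
theorem dual_comp_mem_of_separating {P V : Type*} [AddCommGroup V] [Module ℝ V]
    [FiniteDimensional ℝ V] (A : Submodule ℝ (P → ℝ)) (S : Set (Dual ℝ V))
    (hS : ∀ v : V, (∀ f ∈ S, f v = 0) → v = 0) (F : P → V)
    (hF : ∀ f ∈ S, (fun p => f (F p)) ∈ A) (u : Dual ℝ V) : (fun p => u (F p)) ∈ A := by
  let T : Dual ℝ V →ₗ[ℝ] (P → ℝ) :=
    { toFun := fun u p => u (F p)
      map_add' := fun _ _ => rfl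
      map_smul' := fun _ _ => rfl }
  -- In finite dimension a subspace of the dual is the annihilator of its coannihilator, so a
  -- separating family spans.
  have hspan : Submodule.span ℝ S = ⊤ := by
    have h : (Submodule.span ℝ S).dualCoannihilator = ⊥ := by
      rw [eq_bot_iff]
      intro v hv
      rw [Submodule.mem_dualCoannihilator] at hv
      exact hS v fun f hf => hv f (Submodule.subset_span hf)
    rw [← Subspace.dualCoannihilator_dualAnnihilator_eq (W := Submodule.span ℝ S), h]
    simp
  have hle : Submodule.span ℝ S ≤ A.comap T := Submodule.span_le.2 fun f hf => hF f hf
  have hu : u ∈ Submodule.span ℝ S := hspan ▸ Submodule.mem_top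
  exact hle hu

variable {L : Type*} [LieRing L] [LieAlgebra ℝ L] (𝒢 : ℤ → Submodule ℝ L) [GradedLieAlgebra 𝒢]

/-- The projection of a graded Lie algebra onto its component of degree `i`. -/
def gradedProj (i : ℤ) : L →ₗ[ℝ] L :=
  (𝒢 i).subtype ∘ₗ DirectSum.component ℝ ℤ (fun i => 𝒢 i) i ∘ₗ
    (DirectSum.decomposeLinearEquiv 𝒢).toLinearMap

theorem gradedProj_mem (i : ℤ) (x : L) : gradedProj 𝒢 i x ∈ 𝒢 i :=
  (DirectSum.decompose 𝒢 x i).2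

theorem gradedProj_of_mem {i : ℤ} {x : L} (hx : x ∈ 𝒢 i) : gradedProj 𝒢 i x = x :=
  DirectSum.decompose_of_mem_same 𝒢 hx

theorem gradedProj_of_mem_ne {i j : ℤ} {x : L} (hx : x ∈ 𝒢 i) (hij : i ≠ j) :
    gradedProj 𝒢 j x = 0 :=
  DirectSum.decompose_of_mem_ne 𝒢 hx hij

/-- The finitely many degrees occurring in the vectors of a basis serve for every `x` at once. This
makes the later expansions finite sums independent of the point of `P`. -/
theorem exists_sum_gradedProj [FiniteDimensional ℝ L] :
    ∃ s : Finset ℤ, ∀ x : L, ∑ m ∈ s, gradedProj 𝒢 m x = x := by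
  classical
  let b := Module.finBasis ℝ L
  refine ⟨Finset.univ.biUnion fun j => (DirectSum.decompose 𝒢 (b j)).support, fun x => ?_⟩
  have : (∑ m ∈ Finset.univ.biUnion fun j => (DirectSum.decompose 𝒢 (b j)).support,
      gradedProj 𝒢 m) = LinearMap.id := by
    refine b.ext fun j => ?_
    rw [LinearMap.sum_apply, LinearMap.id_apply]
    conv_rhs => rw [← DirectSum.sum_support_decompose 𝒢 (b j)]
    symm
    refine Finset.sum_subset (Finset.subset_biUnion_of_mem
      (fun j => (DirectSum.decompose 𝒢 (b j)).support) (Finset.mem_univ j)) fun m _ hm => ?_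
    simpa using hm
  simpa using congrArg (fun f : L →ₗ[ℝ] L => f x) this

theorem negPart_hom_ext {M : Type*} [AddCommGroup M] [Module ℝ M] {f g : negPart 𝒢 →ₗ[ℝ] M}
    (h : ∀ i < 0, ∀ x : negPart 𝒢, (x : L) ∈ 𝒢 i → f x = g x) : f = g := by
  ext ⟨x, hx⟩
  change x ∈ ⨆ i : {i : ℤ // i < 0}, 𝒢 i at hx
  -- The induction runs over elements of `L`, so membership in `negPart 𝒢` is carried inside the
  -- motive.
  have key : ∃ hx' : x ∈ negPart 𝒢, f ⟨x, hx'⟩ = g ⟨x, hx'⟩ := by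
    refine Submodule.iSup_induction (fun i : {i : ℤ // i < 0} => 𝒢 i)
      (motive := fun x => ∃ hx' : x ∈ negPart 𝒢, f ⟨x, hx'⟩ = g ⟨x, hx'⟩) hx ?_ ?_ ?_
    · intro i y hy
      have hy' : y ∈ negPart 𝒢 :=
        Submodule.mem_iSup_of_mem (p := fun i : {i : ℤ // i < 0} => 𝒢 i) i hy
      exact ⟨hy', h i i.2 ⟨y, hy'⟩ hy⟩
    · exact ⟨zero_mem _, by
        have : (⟨0, zero_mem _⟩ : negPart 𝒢) = 0 := rfl
        rw [this, map_zero, map_zero]⟩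
    · rintro y z ⟨hy, hy'⟩ ⟨hz, hz'⟩
      refine ⟨add_mem hy hz, ?_⟩
      have : (⟨y + z, add_mem hy hz⟩ : negPart 𝒢) = ⟨y, hy⟩ + ⟨z, hz⟩ := rfl
      rw [this, map_add, map_add, hy', hz']
  exact key.2

theorem mem_negPart {i : ℤ} (hi : i < 0) {x : L} (hx : x ∈ 𝒢 i) : x ∈ negPart 𝒢 :=
  Submodule.mem_iSup_of_mem (p := fun i : {i : ℤ // i < 0} => 𝒢 i) ⟨i, hi⟩ hx

theorem d₂₃_mem {k a b c : ℤ} {φ : Cochain₂ 𝒢} (hφ : φ ∈ homogeneous 𝒢 k) {x y z : negPart 𝒢}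
    (hx : (x : L) ∈ 𝒢 a) (hy : (y : L) ∈ 𝒢 b) (hz : (z : L) ∈ 𝒢 c) :
    d₂₃ ℝ (negPart 𝒢) L φ x y z ∈ 𝒢 (a + b + c + k) := by
  have hl : ∀ {i j : ℤ} {u : negPart 𝒢} {w : L}, (u : L) ∈ 𝒢 i → w ∈ 𝒢 j → ⁅u, w⁆ ∈ 𝒢 (i + j) :=
    fun hu hw => SetLike.GradedBracket.bracket_mem hu hw
  have hl' : ∀ {i j : ℤ} {u w : negPart 𝒢}, (u : L) ∈ 𝒢 i → (w : L) ∈ 𝒢 j →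
      ((⁅u, w⁆ : negPart 𝒢) : L) ∈ 𝒢 (i + j) :=
    fun hu hw => SetLike.GradedBracket.bracket_mem hu hw
  rw [d₂₃_apply]
  refine sub_mem (add_mem (sub_mem (add_mem (sub_mem ?_ ?_) ?_) ?_) ?_) ?_
  · convert hl hx (hφ b c y z hy hz) using 2; ring
  · convert hl hy (hφ a c x z hx hz) using 2; ring
  · convert hl hz (hφ a b x y hx hy) using 2; ring
  · convert hφ _ _ _ _ (hl' hx hy) hz using 2
  · convert hφ _ _ _ _ (hl' hx hz) hy using 2; ring
  · convert hφ _ _ _ _ (hl' hy hz) hx using 2; ring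

/-- Here `ψ` is the degree `k` component of `φ`. It stays in `W` because `W` is graded, and since
`T` and `∂` preserve degree it computes the degree `k` components of `T φ` and `∂φ` as well. By
linearity it is enough to treat homogeneous `φ`, where `ψ` is `φ` itself or `0`. -/
theorem exists_homogeneous_component (W : Submodule ℝ (Cochain₂ 𝒢))
    (hW : W = ⨆ k : ℤ, W ⊓ homogeneous 𝒢 k) (T : W →ₗ[ℝ] Cochain₂ 𝒢)
    (hT : ∀ (k : ℤ) (φ : W), φ.1 ∈ homogeneous 𝒢 k → T φ ∈ homogeneous 𝒢 k) (k : ℤ) (φ : W) :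
    ∃ ψ : W, (∀ (i j : ℤ) (x y : negPart 𝒢), (x : L) ∈ 𝒢 i → (y : L) ∈ 𝒢 j →
        gradedProj 𝒢 (i + j + k) (φ.1 x y) = ψ.1 x y ∧
        gradedProj 𝒢 (i + j + k) (T φ x y) = T ψ x y) ∧
      ∀ (a b c : ℤ) (x y z : negPart 𝒢), (x : L) ∈ 𝒢 a → (y : L) ∈ 𝒢 b → (z : L) ∈ 𝒢 c →
        gradedProj 𝒢 (a + b + c + k) (d₂₃ ℝ (negPart 𝒢) L φ.1 x y z) =
          d₂₃ ℝ (negPart 𝒢) L ψ.1 x y z := by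
  obtain ⟨φ, hφW⟩ := φ
  have hφ : φ ∈ ⨆ k : ℤ, W ⊓ homogeneous 𝒢 k := hW ▸ hφW
  suffices h : ∃ hφW : φ ∈ W, ∃ ψ : W, (∀ (i j : ℤ) (x y : negPart 𝒢), (x : L) ∈ 𝒢 i →
        (y : L) ∈ 𝒢 j → gradedProj 𝒢 (i + j + k) (φ x y) = ψ.1 x y ∧
        gradedProj 𝒢 (i + j + k) (T ⟨φ, hφW⟩ x y) = T ψ x y) ∧
      ∀ (a b c : ℤ) (x y z : negPart 𝒢), (x : L) ∈ 𝒢 a → (y : L) ∈ 𝒢 b → (z : L) ∈ 𝒢 c →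
        gradedProj 𝒢 (a + b + c + k) (d₂₃ ℝ (negPart 𝒢) L φ x y z) =
          d₂₃ ℝ (negPart 𝒢) L ψ.1 x y z from h.2
  refine Submodule.iSup_induction (fun k => W ⊓ homogeneous 𝒢 k)
    (motive := fun φ => ∃ hφW : φ ∈ W, ∃ ψ : W, (∀ (i j : ℤ) (x y : negPart 𝒢), (x : L) ∈ 𝒢 i →
        (y : L) ∈ 𝒢 j → gradedProj 𝒢 (i + j + k) (φ x y) = ψ.1 x y ∧
        gradedProj 𝒢 (i + j + k) (T ⟨φ, hφW⟩ x y) = T ψ x y) ∧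
      ∀ (a b c : ℤ) (x y z : negPart 𝒢), (x : L) ∈ 𝒢 a → (y : L) ∈ 𝒢 b → (z : L) ∈ 𝒢 c →
        gradedProj 𝒢 (a + b + c + k) (d₂₃ ℝ (negPart 𝒢) L φ x y z) =
          d₂₃ ℝ (negPart 𝒢) L ψ.1 x y z) hφ ?_ ?_ ?_
  · rintro m φ ⟨hφW, hφ⟩
    refine ⟨hφW, ?_⟩
    have hTφ := hT m ⟨φ, hφW⟩ hφ
    rcases eq_or_ne m k with rfl | hmk
    · exact ⟨⟨φ, hφW⟩, fun i j x y hx hy => ⟨gradedProj_of_mem 𝒢 (hφ i j x y hx hy),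
        gradedProj_of_mem 𝒢 (hTφ i j x y hx hy)⟩,
        fun a b c x y z hx hy hz => gradedProj_of_mem 𝒢 (d₂₃_mem 𝒢 hφ hx hy hz)⟩
    · refine ⟨0, fun i j x y hx hy => ⟨?_, ?_⟩, fun a b c x y z hx hy hz => ?_⟩
      · rw [gradedProj_of_mem_ne 𝒢 (hφ i j x y hx hy) (by omega)]; rfl
      · rw [gradedProj_of_mem_ne 𝒢 (hTφ i j x y hx hy) (by omega), map_zero]; rfl
      · rw [gradedProj_of_mem_ne 𝒢 (d₂₃_mem 𝒢 hφ hx hy hz) (by omega)]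
        simp only [ZeroMemClass.coe_zero, map_zero, LinearMap.zero_apply]
  · refine ⟨zero_mem _, 0, fun i j x y hx hy => ⟨?_, ?_⟩, fun a b c x y z hx hy hz => ?_⟩
    · exact map_zero (gradedProj 𝒢 (i + j + k))
    · have : (⟨0, zero_mem _⟩ : W) = 0 := rfl
      rw [this, map_zero]
      exact map_zero (gradedProj 𝒢 (i + j + k))
    · simp only [ZeroMemClass.coe_zero, map_zero, LinearMap.zero_apply]
  · rintro φ φ' ⟨hφ, ψ, h1, h2⟩ ⟨hφ', ψ', h1', h2'⟩
    refine ⟨add_mem hφ hφ', ψ + ψ', fun i j x y hx hy => ⟨?_, ?_⟩,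
      fun a b c x y z hx hy hz => ?_⟩
    · rw [add_apply_apply, map_add, (h1 i j x y hx hy).1, (h1' i j x y hx hy).1]; rfl
    · have : (⟨φ + φ', add_mem hφ hφ'⟩ : W) = ⟨φ, hφ⟩ + ⟨φ', hφ'⟩ := rfl
      rw [this, map_add T, map_add T, add_apply_apply, map_add, (h1 i j x y hx hy).2,
        (h1' i j x y hx hy).2, add_apply_apply]
    · rw [Submodule.coe_add, map_add (d₂₃ ℝ (negPart 𝒢) L), map_add (d₂₃ ℝ (negPart 𝒢) L)]
      simp only [LinearMap.add_apply, map_add]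
      rw [h2 a b c x y z hx hy hz, h2' a b c x y z hx hy hz]

theorem gradedProj_eq_zero_of_positive {φ : Cochain₂ 𝒢}
    (hφ : φ ∈ ⨆ k : {k : ℤ // 0 < k}, homogeneous 𝒢 k) {i j k : ℤ} (hk : k ≤ 0)
    {x y : negPart 𝒢} (hx : (x : L) ∈ 𝒢 i) (hy : (y : L) ∈ 𝒢 j) :
    gradedProj 𝒢 (i + j + k) (φ x y) = 0 := by
  refine Submodule.iSup_induction (fun k : {k : ℤ // 0 < k} => homogeneous 𝒢 k)
    (motive := fun φ => gradedProj 𝒢 (i + j + k) (φ x y) = 0) hφ ?_ ?_ ?_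
  · intro m φ hφ
    exact gradedProj_of_mem_ne 𝒢 (hφ i j x y hx hy) (by have := m.2; omega)
  · exact map_zero _
  · intro φ φ' h h'
    rw [add_apply_apply, map_add, h, h', add_zero]

variable [FiniteDimensional ℝ L]

/-- The functionals `φ ↦ v (φ x y)`, for `x` and `y` homogeneous of negative degree, determine all
coefficients of a function with values in `Hom(⋀² 𝔤₋, 𝔤)`. -/
theorem dual_comp_cochain_mem {P : Type*} (A : Submodule ℝ (P → ℝ)) (F : P → Cochain₂ 𝒢)
    (hF : ∀ i < 0, ∀ j < 0, ∀ x y : negPart 𝒢, (x : L) ∈ 𝒢 i → (y : L) ∈ 𝒢 j →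
      ∀ v : Dual ℝ L, (fun p => v (F p x y)) ∈ A)
    (u : Dual ℝ (Cochain₂ 𝒢)) : (fun p => u (F p)) ∈ A := by
  refine dual_comp_mem_of_separating A
    {f | ∃ (i j : ℤ) (x y : negPart 𝒢) (v : Dual ℝ L), i < 0 ∧ j < 0 ∧ (x : L) ∈ 𝒢 i ∧
      (y : L) ∈ 𝒢 j ∧ ∀ φ, f φ = v (φ x y)} ?_ F ?_ u
  · intro φ hφ
    have : φ.1 = 0 := by
      refine negPart_hom_ext 𝒢 fun i hi x hx => negPart_hom_ext 𝒢 fun j hj y hy => ?_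
      refine (forall_dual_apply_eq_zero_iff ℝ (φ x y)).1 fun v => ?_
      exact hφ (v ∘ₗ (LinearMap.applyₗ y) ∘ₗ (LinearMap.applyₗ x) ∘ₗ (Cochain₂ 𝒢).subtype)
        ⟨i, j, x, y, v, hi, hj, hx, hy, fun _ => rfl⟩
    exact Subtype.ext this
  · rintro f ⟨i, j, x, y, v, hi, hj, hx, hy, hf⟩
    simp only [hf]
    exact hF i hi j hj x y hx hy v

/-- A curvature-like function is determined, up to iterated derivatives, by its projection to
`ker ∂`: abstract form, in terms of the Bianchi identity. -/
theorem dual_comp_mem_of_bianchi {P : Type*} (K : P → L → L →ₗ[ℝ] L)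
    (hskew : ∀ p X Y, K p X Y = -K p Y X)
    (hhor : ∀ p, ∀ i ≥ 0, ∀ X ∈ 𝒢 i, ∀ Y, K p X Y = 0)
    (C : P → Cochain₂ 𝒢) (hCK : ∀ p (x y : negPart 𝒢), C p x y = K p x y)
    (A : Subalgebra ℝ (P → ℝ)) (D : L → (P → ℝ) → (P → ℝ)) (hD : ∀ X, ∀ g ∈ A, D X g ∈ A)
    (bianchi : ∀ (v : Dual ℝ L) (X Y Z : L) (p : P),
      v (K p X ⁅Y, Z⁆ + K p Y ⁅Z, X⁆ + K p Z ⁅X, Y⁆ + (⁅X, K p Y Z⁆ + ⁅Y, K p Z X⁆ + ⁅Z, K p X Y⁆)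
        - (K p X (K p Y Z) + K p Y (K p Z X) + K p Z (K p X Y))) =
      -(D X (fun p => v (K p Y Z)) p + D Y (fun p => v (K p Z X)) p +
        D Z (fun p => v (K p X Y)) p))
    (W : Submodule ℝ (Cochain₂ 𝒢)) (hW : W = ⨆ k : ℤ, W ⊓ homogeneous 𝒢 k)
    (hC : ∀ p, C p ∈ W)
    (hpos : ∀ p, C p ∈ ⨆ k : {k : ℤ // 0 < k}, homogeneous 𝒢 k)
    (π : W →ₗ[ℝ] ↥(kerDifferential 𝒢 ⊓ W))
    (hπ : ∀ φ : ↥(kerDifferential 𝒢 ⊓ W), π ⟨φ.1, φ.2.2⟩ = φ)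
    (hπdeg : ∀ (k : ℤ) (φ : W), φ.1 ∈ homogeneous 𝒢 k → (π φ).1 ∈ homogeneous 𝒢 k)
    (hA : ∀ v : Dual ℝ ↥(kerDifferential 𝒢 ⊓ W), (fun p => v (π ⟨C p, hC p⟩)) ∈ A)
    (u : Dual ℝ (Cochain₂ 𝒢)) : (fun p => u (C p)) ∈ A := by
  obtain ⟨s, hs⟩ := exists_sum_gradedProj 𝒢
  let b := Module.finBasis ℝ L
  -- Positivity of `C` covers two arguments of negative degree; horizontality covers all the others.
  have hzero : ∀ {k : ℤ}, k ≤ 0 → ∀ {i j : ℤ} {X Y : L}, X ∈ 𝒢 i → Y ∈ 𝒢 j → ∀ p,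
      gradedProj 𝒢 (i + j + k) (K p X Y) = 0 := by
    intro k hk i j X Y hX hY p
    rcases lt_or_ge i 0 with hi | hi
    · rcases lt_or_ge j 0 with hj | hj
      · have := gradedProj_eq_zero_of_positive 𝒢 (hpos p) hk
          (x := ⟨X, mem_negPart 𝒢 hi hX⟩) (y := ⟨Y, mem_negPart 𝒢 hj hY⟩) hX hY
        rwa [hCK] at this
      · rw [hskew, hhor p j hj Y hY, neg_zero, map_zero]
    · rw [hhor p i hi X hX, map_zero]
  -- Strong induction on the homogeneous degree `k`, started below `0`, where the components vanish.
  -- The arguments have arbitrary degrees because the quadratic terms feed values of `K` back into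
  -- `K`.
  have main : ∀ (n : ℕ) (k : ℤ), k < n → ∀ (i j : ℤ) (X Y : L), X ∈ 𝒢 i → Y ∈ 𝒢 j →
      ∀ v : Dual ℝ L, (fun p => v (gradedProj 𝒢 (i + j + k) (K p X Y))) ∈ A := by
    intro n
    induction n with
    | zero =>
      intro k hk i j X Y hX hY v
      simp only [hzero (k := k) (by simpa using hk.le) hX hY, map_zero]
      exact zero_mem A
    | succ n ih =>
      intro k hk i j X Y hX hY v
      rcases lt_or_ge k n with hkn | hkn
      · exact ih k hkn i j X Y hX hY v
      obtain rfl : k = n := by push_cast at hk; omega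
      rcases lt_or_ge i 0 with hi | hi
      swap
      · simp only [hhor _ i hi X hX, map_zero]; exact zero_mem A
      rcases lt_or_ge j 0 with hj | hj
      swap
      · simp only [hskew _ X Y, hhor _ j hj Y hY, map_zero, neg_zero]; exact zero_mem A
      -- Expanding the inner curvature into homogeneous basis coefficients gives a sum of products.
      -- In the summand of inner value degree `m`, the inner factor has homogeneous degree `m - b' -
      -- c` and the outer one `n - (m - b' - c)`. Either one of them is nonpositive and the product
      -- vanishes, or both are below `n`.
      have quad : ∀ (N a b' c : ℤ) (X Y Z : L), N = a + b' + c + n → X ∈ 𝒢 a → Y ∈ 𝒢 b' →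
          Z ∈ 𝒢 c → ∀ v : Dual ℝ L,
          (fun p => v (gradedProj 𝒢 N (K p X (K p Y Z)))) ∈ A := by
        intro N a b' c X Y Z hN hX hY hZ v
        have hexp : (fun p => v (gradedProj 𝒢 N (K p X (K p Y Z)))) =
            ∑ m ∈ s, ∑ r, (fun p => b.coord r (gradedProj 𝒢 m (K p Y Z))) *
              (fun p => v (gradedProj 𝒢 N (K p X (gradedProj 𝒢 m (b r))))) := by
          funext p
          have h1 : K p Y Z = ∑ m ∈ s, ∑ r, b.coord r (gradedProj 𝒢 m (K p Y Z)) •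
              gradedProj 𝒢 m (b r) := by
            conv_lhs => rw [← hs (K p Y Z)]
            refine Finset.sum_congr rfl fun m _ => ?_
            have h2 := congrArg (gradedProj 𝒢 m) (b.sum_repr (gradedProj 𝒢 m (K p Y Z)))
            rw [gradedProj_of_mem 𝒢 (gradedProj_mem 𝒢 m (K p Y Z)), map_sum] at h2
            simpa only [map_smul, Module.Basis.coord_apply] using h2.symm
          conv_lhs => rw [h1]
          simp only [map_sum, map_smul, Finset.sum_apply, Pi.mul_apply, smul_eq_mul]
        rw [hexp]
        refine sum_mem fun m _ => sum_mem fun r _ => ?_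
        have hm1 : m = b' + c + (m - b' - c) := by ring
        have hm2 : N = a + m + (n - (m - b' - c)) := by rw [hN]; ring
        have he := gradedProj_mem 𝒢 m (b r)
        rcases le_or_gt (m - b' - c) 0 with h0 | h0
        · have : (fun p => b.coord r (gradedProj 𝒢 m (K p Y Z))) = 0 := by
            funext p
            rw [hm1, hzero h0 hY hZ, map_zero]; rfl
          rw [this, zero_mul]; exact zero_mem A
        rcases le_or_gt (n : ℤ) (m - b' - c) with h1 | h1
        · have : (fun p => v (gradedProj 𝒢 N (K p X (gradedProj 𝒢 m (b r))))) = 0 := by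
            funext p
            rw [hm2, hzero (by omega) hX he, map_zero]; rfl
          rw [this, mul_zero]; exact zero_mem A
        · refine mul_mem ?_ ?_
          · conv => enter [2, p]; rw [hm1]
            exact ih _ h1 _ _ _ _ hY hZ _
          · conv => enter [2, p]; rw [hm2]
            exact ih _ (by omega) _ _ _ _ hX he _
      -- Relative to `b' + c`, the value degree `N` corresponds to homogeneous degree `a + n`, which
      -- is below `n` since `a < 0`.
      have hder : ∀ (N a b' c : ℤ) (X Y Z : L), N = a + b' + c + n → a < 0 → Y ∈ 𝒢 b' →
          Z ∈ 𝒢 c → ∀ v : Dual ℝ L,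
          D X (fun p => (v ∘ₗ gradedProj 𝒢 N) (K p Y Z)) ∈ A := by
        intro N a b' c X Y Z hN ha hY hZ v
        refine hD X _ ?_
        obtain rfl : N = b' + c + (a + n) := by rw [hN]; ring
        exact ih _ (by omega) _ _ _ _ hY hZ v
      have hd : ∀ (a b' c : ℤ) (x y z : negPart 𝒢), a < 0 → b' < 0 → c < 0 → (x : L) ∈ 𝒢 a →
          (y : L) ∈ 𝒢 b' → (z : L) ∈ 𝒢 c → ∀ v : Dual ℝ L,
          (fun p => v (gradedProj 𝒢 (a + b' + c + n) (d₂₃ ℝ (negPart 𝒢) L (C p) x y z))) ∈ A := by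
        intro a b' c x y z ha hb hc hx hy hz v
        -- The cochain differential is the linear part of the Bianchi expression; the quadratic part
        -- is subtracted and added back so that `bianchi` applies verbatim.
        have hform : ∀ p, d₂₃ ℝ (negPart 𝒢) L (C p) x y z =
            (K p x ⁅(y : L), (z : L)⁆ + K p y ⁅(z : L), (x : L)⁆ + K p z ⁅(x : L), (y : L)⁆ +
              (⁅(x : L), K p y z⁆ + ⁅(y : L), K p z x⁆ + ⁅(z : L), K p x y⁆)
              - (K p x (K p y z) + K p y (K p z x) + K p z (K p x y))) +
            (K p x (K p y z) + K p y (K p z x) + K p z (K p x y)) := by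
          intro p
          have e1 : ∀ u w t : negPart 𝒢, C p ⁅u, w⁆ t = -K p t ⁅(u : L), (w : L)⁆ := by
            intro u w t
            rw [hCK, hskew]; rfl
          have e2 : ∀ (u : negPart 𝒢) (w : L), ⁅u, w⁆ = ⁅(u : L), w⁆ := fun _ _ => rfl
          rw [d₂₃_apply, e1, e1, e1, hCK, hCK, hCK, e2, e2, e2, hskew p x z, lie_neg,
            ← lie_skew (x : L) (z : L), map_neg]
          abel
        have : (fun p => v (gradedProj 𝒢 (a + b' + c + n) (d₂₃ ℝ (negPart 𝒢) L (C p) x y z))) =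
            -(D x (fun p => (v ∘ₗ gradedProj 𝒢 (a + b' + c + n)) (K p y z)) +
              D y (fun p => (v ∘ₗ gradedProj 𝒢 (a + b' + c + n)) (K p z x)) +
              D z (fun p => (v ∘ₗ gradedProj 𝒢 (a + b' + c + n)) (K p x y))) +
            ((fun p => v (gradedProj 𝒢 (a + b' + c + n) (K p x (K p y z)))) +
              (fun p => v (gradedProj 𝒢 (a + b' + c + n) (K p y (K p z x)))) +
              (fun p => v (gradedProj 𝒢 (a + b' + c + n) (K p z (K p x y))))) := by
          funext p
          have hb := bianchi (v ∘ₗ gradedProj 𝒢 (a + b' + c + n)) x y z p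
          rw [LinearMap.comp_apply] at hb
          rw [hform, map_add (gradedProj 𝒢 (a + b' + c + n)), map_add v, hb]
          simp only [map_add, Pi.add_apply, Pi.neg_apply]
        rw [this]
        refine add_mem (neg_mem (add_mem (add_mem ?_ ?_) ?_)) (add_mem (add_mem ?_ ?_) ?_)
        · exact hder _ a b' c _ _ _ rfl ha hy hz v
        · exact hder _ b' c a _ _ _ (by ring) hb hz hx v
        · exact hder _ c a b' _ _ _ (by ring) hc hx hy v
        · exact quad _ a b' c _ _ _ rfl hx hy hz v
        · exact quad _ b' c a _ _ _ (by ring) hy hz hx v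
        · exact quad _ c a b' _ _ _ (by ring) hz hx hy v
      let T : W →ₗ[ℝ] Cochain₂ 𝒢 := (kerDifferential 𝒢 ⊓ W).subtype ∘ₗ π
      -- `ψ p` is the degree `n` component of `C p`.
      choose ψ hψ1 hψ2 using fun p =>
        exists_homogeneous_component 𝒢 W hW T hπdeg (n : ℤ) ⟨C p, hC p⟩
      have hTψ : ∀ w : Dual ℝ (Cochain₂ 𝒢), (fun p => w (T (ψ p))) ∈ A := by
        intro w
        refine dual_comp_cochain_mem 𝒢 A.toSubmodule _ (fun i hi j hj x y hx hy v => ?_) w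
        have : (fun p => v (T (ψ p) x y)) =
            fun p => v (gradedProj 𝒢 (i + j + n) (T ⟨C p, hC p⟩ x y)) :=
          funext fun p => congrArg v (hψ1 p i j x y hx hy).2.symm
        rw [this]
        exact hA (v ∘ₗ gradedProj 𝒢 (i + j + n) ∘ₗ (LinearMap.applyₗ y) ∘ₗ
          (LinearMap.applyₗ x) ∘ₗ (Cochain₂ 𝒢).subtype ∘ₗ (kerDifferential 𝒢 ⊓ W).subtype)
      have hdψ : ∀ w : Dual ℝ (negPart 𝒢 →ₗ[ℝ] negPart 𝒢 →ₗ[ℝ] negPart 𝒢 →ₗ[ℝ] L),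
          (fun p => w (d₂₃ ℝ (negPart 𝒢) L (ψ p).1)) ∈ A := by
        intro w
        refine dual_comp_mem_of_separating A.toSubmodule
          {f | ∃ (a b' c : ℤ) (x y z : negPart 𝒢) (v : Dual ℝ L), a < 0 ∧ b' < 0 ∧ c < 0 ∧
            (x : L) ∈ 𝒢 a ∧ (y : L) ∈ 𝒢 b' ∧ (z : L) ∈ 𝒢 c ∧ ∀ φ, f φ = v (φ x y z)} ?_ _ ?_ w
        · intro φ hφ
          refine negPart_hom_ext 𝒢 fun i hi x hx => negPart_hom_ext 𝒢 fun j hj y hy =>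
            negPart_hom_ext 𝒢 fun c hc z hz => ?_
          rw [LinearMap.zero_apply, LinearMap.zero_apply, LinearMap.zero_apply,
            ← forall_dual_apply_eq_zero_iff ℝ]
          intro v
          exact hφ (v ∘ₗ (LinearMap.applyₗ z) ∘ₗ (LinearMap.applyₗ y) ∘ₗ (LinearMap.applyₗ x))
            ⟨i, j, c, x, y, z, v, hi, hj, hc, hx, hy, hz, fun _ => rfl⟩
        · rintro f ⟨a, b', c, x, y, z, v, ha, hb, hc, hx, hy, hz, hf⟩
          have : (fun p => f (d₂₃ ℝ (negPart 𝒢) L (ψ p).1)) = fun p =>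
              v (gradedProj 𝒢 (a + b' + c + n) (d₂₃ ℝ (negPart 𝒢) L (C p) x y z)) := by
            funext p
            rw [hf, hψ2 p a b' c x y z hx hy hz]
          rw [this]
          exact hd a b' c x y z ha hb hc hx hy hz v
      let x : negPart 𝒢 := ⟨X, mem_negPart 𝒢 hi hX⟩
      let y : negPart 𝒢 := ⟨Y, mem_negPart 𝒢 hj hY⟩
      let ev : Cochain₂ 𝒢 →ₗ[ℝ] ℝ :=
        v ∘ₗ (LinearMap.applyₗ y) ∘ₗ (LinearMap.applyₗ x) ∘ₗ (Cochain₂ 𝒢).subtype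
      -- The functional `ev ∘ (id - π)` kills `ker ∂ ∩ W`, so it factors through `∂` restricted to
      -- `W`: the range of a dual map is the annihilator of the kernel.
      have hmem : ev ∘ₗ (W.subtype - T) ∈
          LinearMap.range (d₂₃ ℝ (negPart 𝒢) L ∘ₗ W.subtype).dualMap := by
        rw [LinearMap.range_dualMap_eq_dualAnnihilator_ker, Submodule.mem_dualAnnihilator]
        intro φ hφ
        have h := hπ ⟨φ.1, hφ, φ.2⟩
        have : T φ = φ.1 := congrArg Subtype.val h
        rw [LinearMap.comp_apply, LinearMap.sub_apply, this, Submodule.subtype_apply, sub_self,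
          map_zero]
      obtain ⟨w, hw⟩ := hmem
      -- `ψ = (ψ - π ψ) + π ψ`: the first term is read off from `∂ψ` through `w`, the second from `π
      -- ψ`.
      have : (fun p => v (gradedProj 𝒢 (i + j + n) (K p X Y))) =
          (fun p => w (d₂₃ ℝ (negPart 𝒢) L (ψ p).1)) + fun p => ev (T (ψ p)) := by
        funext p
        have h1 : w (d₂₃ ℝ (negPart 𝒢) L (ψ p).1) = ev ((ψ p).1 - T (ψ p)) :=
          congrArg (fun f : Dual ℝ W => f (ψ p)) hw
        rw [Pi.add_apply, h1, map_sub, sub_add_cancel]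
        have h2 := (hψ1 p i j x y hX hY).1
        rw [hCK] at h2
        exact congrArg v h2
      rw [this]
      exact add_mem (hdψ w) (hTψ ev)
  refine dual_comp_cochain_mem 𝒢 A.toSubmodule _ (fun i hi j hj x y hx hy v => ?_) u
  have : (fun p => v (C p x y)) = ∑ m ∈ s, fun p => v (gradedProj 𝒢 m (K p x y)) := by
    funext p
    rw [hCK]
    conv_lhs => rw [← hs (K p x y)]
    rw [map_sum, Finset.sum_apply]
  rw [this]
  refine sum_mem fun m _ => ?_
  have hm : m = i + j + (m - i - j) := by ring
  conv => enter [2, p]; rw [hm]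
  -- With `k = m - i - j`, the bound `k < (k + 1).toNat` also holds for negative `k`.
  exact main (m - i - j + 1).toNat _ (by omega) i j x y hx hy v

end Algebra

/-! ### Smoothness of the constant vector fields. -/

section Coframing

open VectorField Bundle

variable {EG EH EM EP : Type*}
  [NormedAddCommGroup EG] [NormedSpace ℝ EG]
  [NormedAddCommGroup EH] [NormedSpace ℝ EH]
  [NormedAddCommGroup EM] [NormedSpace ℝ EM]
  [NormedAddCommGroup EP] [NormedSpace ℝ EP]
  {G H M P : Type*}
  [Group G] [TopologicalSpace G] [ChartedSpace EG G]
  [Group H] [TopologicalSpace H] [ChartedSpace EH H]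
  [TopologicalSpace M] [ChartedSpace EM M]
  [TopologicalSpace P] [ChartedSpace EP P]

theorem contMDiffAt_clm_of_apply {F : Type*} [NormedAddCommGroup F] [NormedSpace ℝ F]
    [FiniteDimensional ℝ EP] {n : ℕ∞ω} {f : P → EP →L[ℝ] F} {p : P}
    (h : ∀ v : EP, ContMDiffAt 𝓘(ℝ, EP) 𝓘(ℝ, F) n (fun q => f q v) p) :
    ContMDiffAt 𝓘(ℝ, EP) 𝓘(ℝ, EP →L[ℝ] F) n f p := by
  let b := Module.finBasis ℝ EP
  have hf : f = fun q => ∑ i, ContinuousLinearMap.smulRightL ℝ EP F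
      (LinearMap.toContinuousLinearMap (b.coord i)) (f q (b i)) := by
    funext q
    ext v
    conv_lhs => rw [← b.sum_repr v]
    simp only [map_sum, map_smul]
    rw [_root_.sum_apply]
    rfl
  rw [hf]
  refine contMDiffAt_finsetSum fun i _ => ?_
  exact (ContinuousLinearMap.contMDiff _).contMDiffAt.comp p (h (b i))

theorem apply_symm_ofBijective {V V' : Type*} [AddCommGroup V] [Module ℝ V] [AddCommGroup V']
    [Module ℝ V'] (f : V →ₗ[ℝ] V') (hf : Function.Bijective f) (x : V') :
    f ((LinearEquiv.ofBijective f hf).symm.toLinearMap x) = x :=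
  LinearEquiv.apply_ofBijective_symm_apply f x

variable [IsManifold 𝓘(ℝ, EP) ∞ P] {ι : H →* G} {B : PrincipalBundle EH EM EP H M P}

namespace CartanConnection

theorem form_inv (θ : CartanConnection (EG := EG) ι B) (p : P) (X : GroupLieAlgebra 𝓘(ℝ, EG) G) :
    θ.form p (θ.inv p X) = X :=
  apply_symm_ofBijective (θ.form p).toLinearMap (θ.bijective p) X

theorem inv_form (θ : CartanConnection (EG := EG) ι B) (p : P) (v : TangentSpace 𝓘(ℝ, EP) p) :
    θ.inv p (θ.form p v) = v :=
  (θ.bijective p).1 (θ.form_inv p _)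

/-- The Cartan connection in the trivialization of the tangent bundle at `p₀`. -/
def localForm (θ : CartanConnection (EG := EG) ι B) (p₀ p : P) : EP →L[ℝ] EG :=
  ((lieToModel EG G).toContinuousLinearMap.comp (θ.form p)).comp
    ((trivializationAt EP (TangentSpace 𝓘(ℝ, EP)) p₀).symmL ℝ p)

theorem localForm_apply (θ : CartanConnection (EG := EG) ι B) {p₀ p : P}
    (hp : p ∈ (trivializationAt EP (TangentSpace 𝓘(ℝ, EP)) p₀).baseSet) (v : EP) :
    θ.localForm p₀ p v = lieToModel EG G
      (θ.form p ((trivializationAt EP (TangentSpace 𝓘(ℝ, EP)) p₀).symm p v)) := by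
  rw [← Trivialization.symmL_apply (R := ℝ) _ hp]
  rfl

theorem contMDiffAt_localForm [FiniteDimensional ℝ EP] (θ : CartanConnection (EG := EG) ι B)
    (p₀ : P) : ContMDiffAt 𝓘(ℝ, EP) 𝓘(ℝ, EP →L[ℝ] EG) ∞ (θ.localForm p₀) p₀ := by
  refine contMDiffAt_clm_of_apply fun v => ?_
  let e := trivializationAt EP (TangentSpace 𝓘(ℝ, EP)) p₀
  have hs : ContMDiffAt 𝓘(ℝ, EP) (𝓘(ℝ, EP)).tangent ∞
      (fun p => e.toOpenPartialHomeomorph.symm (p, v)) p₀ := by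
    have h1 := (e.contMDiffOn_symm (IB := 𝓘(ℝ, EP)) (n := ∞)).contMDiffAt (x := (p₀, v))
      (e.open_target.mem_nhds (by simp [e]))
    exact h1.comp p₀ (contMDiffAt_id.prodMk contMDiffAt_const)
  refine ((θ.contMDiff_form.contMDiffAt).comp p₀ hs).congr_of_eventuallyEq ?_
  filter_upwards [e.open_baseSet.mem_nhds (mem_baseSet_trivializationAt EP _ p₀)] with p hp
  have : e.toOpenPartialHomeomorph.symm (p, v) = ⟨p, e.symm p v⟩ := (e.mk_symm hp v).symm
  rw [Function.comp_apply, this, θ.localForm_apply hp]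

theorem bijective_localForm [FiniteDimensional ℝ EP] (θ : CartanConnection (EG := EG) ι B)
    {p₀ p : P} (hp : p ∈ (trivializationAt EP (TangentSpace 𝓘(ℝ, EP)) p₀).baseSet) :
    Function.Bijective (θ.localForm p₀ p) := by
  have h1 : Function.Bijective ((trivializationAt EP (TangentSpace 𝓘(ℝ, EP)) p₀).symmL ℝ p) := by
    have h2 := ((trivializationAt EP (TangentSpace 𝓘(ℝ, EP)) p₀).continuousLinearEquivAt
      ℝ p hp).symm.bijective
    rwa [Trivialization.symm_continuousLinearEquivAt_eq] at h2
  exact ((lieToModel EG G).bijective.comp (θ.bijective p)).comp h1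

/-- The constant vector fields of a Cartan connection are smooth. -/
theorem contMDiff_inv [FiniteDimensional ℝ EP] (θ : CartanConnection (EG := EG) ι B)
    (X : GroupLieAlgebra 𝓘(ℝ, EG) G) :
    ContMDiff 𝓘(ℝ, EP) (𝓘(ℝ, EP)).tangent ∞
      (fun p => (⟨p, θ.inv p X⟩ : TangentBundle 𝓘(ℝ, EP) P)) := by
  intro p₀
  rw [contMDiffAt_section]
  let e := trivializationAt EP (TangentSpace 𝓘(ℝ, EP)) p₀
  have hb : ∀ p ∈ e.baseSet, ∃ E : EP ≃L[ℝ] EG, (E : EP →L[ℝ] EG) = θ.localForm p₀ p := by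
    intro p hp
    have hfin : FiniteDimensional ℝ EG :=
      Module.Finite.of_surjective (θ.localForm p₀ p).toLinearMap (θ.bijective_localForm hp).2
    refine ⟨(LinearEquiv.ofBijective (θ.localForm p₀ p).toLinearMap
      (θ.bijective_localForm hp)).toContinuousLinearEquiv, ?_⟩
    ext v
    rfl
  have hp₀ := mem_baseSet_trivializationAt EP (TangentSpace 𝓘(ℝ, EP)) p₀
  obtain ⟨E₀, hE₀⟩ := hb p₀ hp₀
  have hcomplete : CompleteSpace EP := FiniteDimensional.complete ℝ EP
  -- Inversion of operators is smooth near an invertible one, and near `p₀` the inverse of the local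
  -- form represents `θ.inv` in the trivialization.
  have hinv : ContMDiffAt 𝓘(ℝ, EP) 𝓘(ℝ, EG →L[ℝ] EP) ∞
      (fun p => ContinuousLinearMap.inverse (θ.localForm p₀ p)) p₀ := by
    have h1 : ContDiffAt ℝ ∞ (ContinuousLinearMap.inverse : (EP →L[ℝ] EG) → EG →L[ℝ] EP)
        (θ.localForm p₀ p₀) := hE₀ ▸ contDiffAt_map_inverse E₀
    exact h1.contMDiffAt.comp p₀ (θ.contMDiffAt_localForm p₀)
  have happ := hinv.clm_apply
    (contMDiffAt_const (c := lieToModel EG G X) : ContMDiffAt 𝓘(ℝ, EP) 𝓘(ℝ, EG) ∞ _ p₀)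
  refine happ.congr_of_eventuallyEq ?_
  filter_upwards [e.open_baseSet.mem_nhds hp₀] with p hp
  obtain ⟨E, hE⟩ := hb p hp
  rw [← hE, ContinuousLinearMap.inverse_equiv]
  change _ = E.symm (lieToModel EG G X)
  rw [ContinuousLinearEquiv.eq_symm_apply]
  change (E : EP →L[ℝ] EG) _ = _
  rw [hE, θ.localForm_apply hp, e.symm_apply_apply_mk hp, form_inv]

end CartanConnection

end Coframing

/-! ### Vector fields and Lie brackets in a chart. -/

section Chart

open VectorField

variable {E N : Type*} [NormedAddCommGroup E] [NormedSpace ℝ E] [TopologicalSpace N]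
  [ChartedSpace E N]

/-- A vector field in the chart at `p`. -/
def chartField (V : ∀ n : N, TangentSpace 𝓘(ℝ, E) n) (p : N) (y : E) : E :=
  mfderiv 𝓘(ℝ, E) 𝓘(ℝ, E) (extChartAt 𝓘(ℝ, E) p) ((extChartAt 𝓘(ℝ, E) p).symm y)
    (V ((extChartAt 𝓘(ℝ, E) p).symm y))

theorem chartField_apply (V : ∀ n : N, TangentSpace 𝓘(ℝ, E) n) {p q : N}
    (hq : q ∈ (extChartAt 𝓘(ℝ, E) p).source) :
    chartField V p (extChartAt 𝓘(ℝ, E) p q) =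
      mfderiv 𝓘(ℝ, E) 𝓘(ℝ, E) (extChartAt 𝓘(ℝ, E) p) q (V q) := by
  rw [chartField, (extChartAt 𝓘(ℝ, E) p).left_inv hq]

variable [IsManifold 𝓘(ℝ, E) ∞ N]

theorem chartField_self (V : ∀ n : N, TangentSpace 𝓘(ℝ, E) n) (p : N) :
    chartField V p (extChartAt 𝓘(ℝ, E) p p) = V p := by
  rw [chartField_apply V (mem_extChartAt_source p)]
  have := mfderiv_extChartAt_self (I := 𝓘(ℝ, E)) (x := p)
  rw [this]
  rfl

theorem mpullbackWithin_eqOn_chartField (V : ∀ n : N, TangentSpace 𝓘(ℝ, E) n) (p : N) :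
    Set.EqOn (mpullbackWithin 𝓘(ℝ, E) 𝓘(ℝ, E) (extChartAt 𝓘(ℝ, E) p).symm V
      (Set.range 𝓘(ℝ, E)) : E → E) (chartField V p) (extChartAt 𝓘(ℝ, E) p).target := by
  intro y hy
  rw [mpullbackWithin_apply, chartField, ContinuousLinearMap.inverse_eq
    (mfderivWithin_extChartAt_symm_comp_mfderiv_extChartAt hy)
    (mfderiv_extChartAt_comp_mfderivWithin_extChartAt_symm hy)]
  rfl

/-- No differential of the chart appears on the right: the tangent space at `p` is identified with
`E` by the preferred chart at `p`, whose derivative at `p` is therefore the identity. -/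
theorem mlieBracket_eq_lieBracket_chartField (V W : ∀ n : N, TangentSpace 𝓘(ℝ, E) n) (p : N) :
    mlieBracket 𝓘(ℝ, E) V W p =
      lieBracket ℝ (chartField V p) (chartField W p) (extChartAt 𝓘(ℝ, E) p p) := by
  have ht := extChartAt_target_mem_nhds (I := 𝓘(ℝ, E)) p
  have h1 := Filter.EventuallyEq.lieBracket_vectorField_eq (𝕜 := ℝ)
    (Filter.eventuallyEq_of_mem ht (mpullbackWithin_eqOn_chartField V p))
    (Filter.eventuallyEq_of_mem ht (mpullbackWithin_eqOn_chartField W p))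
  have hinv : ∀ v : E, ContinuousLinearMap.inverse
      (mfderiv 𝓘(ℝ, E) 𝓘(ℝ, E) (extChartAt 𝓘(ℝ, E) p) p : E →L[ℝ] E) v = v := by
    intro v
    refine (congrArg (fun f : E →L[ℝ] E => f.inverse v)
      (mfderiv_extChartAt_self (I := 𝓘(ℝ, E)) (x := p))).trans ?_
    exact congrArg (fun f : E →L[ℝ] E => f v) ContinuousLinearMap.inverse_id
  rw [← h1, ← mlieBracketWithin_univ, mlieBracketWithin_apply]
  refine (hinv _).trans ?_
  simp only [Set.preimage_univ, modelWithCornersSelf_coe, Set.range_id, Set.univ_inter]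
  exact congrFun (lieBracketWithin_univ (E := E) (𝕜 := ℝ)) _

theorem differentiableAt_chartField [CompleteSpace E]
    {V : ∀ n : N, TangentSpace 𝓘(ℝ, E) n} {p : N}
    (hV : MDifferentiableAt 𝓘(ℝ, E) (𝓘(ℝ, E)).tangent
      (fun n => (⟨n, V n⟩ : TangentBundle 𝓘(ℝ, E) N)) p) :
    DifferentiableAt ℝ (chartField V p) (extChartAt 𝓘(ℝ, E) p p) := by
  have h1 := (mdifferentiableWithinAt_univ.2
    hV).differentiableWithinAt_mpullbackWithin_vectorField
  simp only [Set.preimage_univ, modelWithCornersSelf_coe, Set.range_id, Set.univ_inter] at h1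
  refine (differentiableWithinAt_univ.1 h1).congr_of_eventuallyEq ?_
  have := mpullbackWithin_eqOn_chartField V p
  simp only [modelWithCornersSelf_coe, Set.range_id] at this
  exact (Filter.eventuallyEq_of_mem (extChartAt_target_mem_nhds (I := 𝓘(ℝ, E)) p) this).symm

end Chart

/-! ### The exterior derivative of a 1-form on a vector space. -/

section ExteriorDerivative

open VectorField

variable {E F : Type*} [NormedAddCommGroup E] [NormedSpace ℝ E] [NormedAddCommGroup F]
  [NormedSpace ℝ F]

theorem extDeriv_ofSubsingleton_apply {β : E → E →L[ℝ] F} {y : E} (hβ : DifferentiableAt ℝ β y)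
    (v w : E) :
    extDeriv (fun y => ContinuousAlternatingMap.ofSubsingleton ℝ E F (0 : Fin 1) (β y)) y ![v, w] =
      fderiv ℝ β y v w - fderiv ℝ β y w v := by
  have hd : DifferentiableAt ℝ
      (fun y => ContinuousAlternatingMap.ofSubsingleton ℝ E F (0 : Fin 1) (β y)) y :=
    ((ContinuousAlternatingMap.ofSubsingletonLIE (𝕜 := ℝ) (E := E) (F := F)
      (0 : Fin 1)).toContinuousLinearEquiv.differentiableAt).comp y hβ
  have h1 : ∀ w : E, (fun y => ContinuousAlternatingMap.ofSubsingleton ℝ E F (0 : Fin 1) (β y)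
      (fun _ => w)) = fun y => β y w := fun w => rfl
  have h2 : ∀ w v : E, fderiv ℝ (fun y => β y w) y v = fderiv ℝ β y v w := by
    intro w v
    rw [fderiv_clm_apply hβ (differentiableAt_const w)]
    simp
  have r0 : (0 : Fin 2).removeNth ![v, w] = fun _ => w := by
    ext i; fin_cases i; rfl
  have r1 : (1 : Fin 2).removeNth ![v, w] = fun _ => v := by
    ext i; fin_cases i; rfl
  rw [extDeriv_apply hd, Fin.sum_univ_two, r0, r1, h1, h1, h2]
  simp [h2, sub_eq_add_neg]

/-- For vector fields on which a `1`-form takes constant values, the exterior derivative is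
minus the value on the Lie bracket. -/
theorem extDeriv_apply_of_const {β : E → E →L[ℝ] F} {y : E} (hβ : DifferentiableAt ℝ β y)
    {V W : E → E} (hV : DifferentiableAt ℝ V y) (hW : DifferentiableAt ℝ W y) {c d : F}
    (hc : ∀ᶠ z in 𝓝 y, β z (V z) = c) (hd : ∀ᶠ z in 𝓝 y, β z (W z) = d) :
    extDeriv (fun y => ContinuousAlternatingMap.ofSubsingleton ℝ E F (0 : Fin 1) (β y)) y
      ![V y, W y] = -β y (lieBracket ℝ V W y) := by
  -- Differentiating the locally constant function `β(U)` trades a derivative of `β` for one of `U`.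
  have key : ∀ {U : E → E} {c : F}, DifferentiableAt ℝ U y → (∀ᶠ z in 𝓝 y, β z (U z) = c) →
      ∀ u : E, fderiv ℝ β y u (U y) = -β y (fderiv ℝ U y u) := by
    intro U c hU hc u
    have h1 : fderiv ℝ (fun z => β z (U z)) y = 0 := by
      have : (fun z => β z (U z)) =ᶠ[𝓝 y] fun _ => c := hc
      rw [this.fderiv_eq]
      simp
    rw [fderiv_clm_apply hβ hU] at h1
    have h2 := congrArg (fun f : E →L[ℝ] F => f u) h1
    simp only [_root_.add_apply, ContinuousLinearMap.comp_apply,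
      ContinuousLinearMap.flip_apply, _root_.zero_apply] at h2
    rw [eq_neg_iff_add_eq_zero, add_comm]
    exact h2
  rw [extDeriv_ofSubsingleton_apply hβ, key hW hd, key hV hc, lieBracket, map_sub]
  abel

end ExteriorDerivative

/-! ### Curvature as the defect of the bracket of constant fields. -/

section Curvature

open VectorField Bundle

variable {EG EH EM EP : Type*}
  [NormedAddCommGroup EG] [NormedSpace ℝ EG]
  [NormedAddCommGroup EH] [NormedSpace ℝ EH]
  [NormedAddCommGroup EM] [NormedSpace ℝ EM]
  [NormedAddCommGroup EP] [NormedSpace ℝ EP]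
  {G H M P : Type*}
  [Group G] [TopologicalSpace G] [ChartedSpace EG G]
  [Group H] [TopologicalSpace H] [ChartedSpace EH H]
  [TopologicalSpace M] [ChartedSpace EM M]
  [TopologicalSpace P] [ChartedSpace EP P]
  [IsManifold 𝓘(ℝ, EP) ∞ P] {ι : H →* G} {B : PrincipalBundle EH EM EP H M P}

namespace CartanConnection

/-- This reconciles two descriptions of the connection: the trivialization of the tangent bundle, in
which smoothness is known, and the pullback by the inverse chart, which defines `extDerivOneForm`.
-/
theorem localForm_extChartAt_symm (θ : CartanConnection (EG := EG) ι B) (p : P) {y : EP}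
    (hy : y ∈ (extChartAt 𝓘(ℝ, EP) p).target) :
    θ.localForm p ((extChartAt 𝓘(ℝ, EP) p).symm y) =
      ((lieToModel EG G).toContinuousLinearMap.comp
        (θ.form ((extChartAt 𝓘(ℝ, EP) p).symm y))).comp
        (mfderiv 𝓘(ℝ, EP) 𝓘(ℝ, EP) (extChartAt 𝓘(ℝ, EP) p).symm y) := by
  have h1 : (extChartAt 𝓘(ℝ, EP) p).symm y ∈ (chartAt EP p).source := by
    have := (extChartAt 𝓘(ℝ, EP) p).map_target hy
    rwa [extChartAt_source] at this
  have h2 := TangentBundle.symmL_trivializationAt (I := 𝓘(ℝ, EP)) h1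
  rw [(extChartAt 𝓘(ℝ, EP) p).right_inv hy, modelWithCornersSelf_coe, Set.range_id,
    mfderivWithin_univ] at h2
  rw [localForm, h2]
  rfl

theorem localForm_self (θ : CartanConnection (EG := EG) ι B) (p : P)
    (v : TangentSpace 𝓘(ℝ, EP) p) : θ.localForm p p v = lieToModel EG G (θ.form p v) := by
  have h := (TangentBundle.symmL_trivializationAt (I := 𝓘(ℝ, EP)) (mem_chart_source EP p)).trans
    mfderivWithin_range_extChartAt_symm
  exact congrArg (fun f : EP →L[ℝ] EP => lieToModel EG G (θ.form p (f v))) h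

theorem localForm_chartField (θ : CartanConnection (EG := EG) ι B) (p : P)
    (X : GroupLieAlgebra 𝓘(ℝ, EG) G) {y : EP} (hy : y ∈ (extChartAt 𝓘(ℝ, EP) p).target) :
    θ.localForm p ((extChartAt 𝓘(ℝ, EP) p).symm y) (chartField (fun q => θ.inv q X) p y) =
      lieToModel EG G X := by
  have h := mfderivWithin_extChartAt_symm_comp_mfderiv_extChartAt (I := 𝓘(ℝ, EP)) hy
  rw [modelWithCornersSelf_coe, Set.range_id, mfderivWithin_univ] at h
  have h1 := congrArg (fun f => f (θ.inv ((extChartAt 𝓘(ℝ, EP) p).symm y) X)) h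
  rw [θ.localForm_extChartAt_symm p hy]
  change lieToModel EG G (θ.form ((extChartAt 𝓘(ℝ, EP) p).symm y) _) = _
  refine congrArg (lieToModel EG G) (Eq.trans (congrArg (θ.form _) h1) ?_)
  exact θ.form_inv _ X

variable [FiniteDimensional ℝ EP]

theorem mdifferentiableAt_inv (θ : CartanConnection (EG := EG) ι B)
    (X : GroupLieAlgebra 𝓘(ℝ, EG) G) (p : P) :
    MDifferentiableAt 𝓘(ℝ, EP) (𝓘(ℝ, EP)).tangent
      (fun p => (⟨p, θ.inv p X⟩ : TangentBundle 𝓘(ℝ, EP) P)) p :=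
  (θ.contMDiff_inv X).mdifferentiableAt (by simp)

theorem differentiableAt_localForm (θ : CartanConnection (EG := EG) ι B) (p : P) :
    DifferentiableAt ℝ (fun y => θ.localForm p ((extChartAt 𝓘(ℝ, EP) p).symm y))
      (extChartAt 𝓘(ℝ, EP) p p) := by
  have hs : ContMDiffAt 𝓘(ℝ, EP) 𝓘(ℝ, EP) ∞ (extChartAt 𝓘(ℝ, EP) p).symm
      (extChartAt 𝓘(ℝ, EP) p p) :=
    (contMDiffOn_extChartAt_symm p).contMDiffAt (extChartAt_target_mem_nhds p)
  have h1 : ContMDiffAt 𝓘(ℝ, EP) 𝓘(ℝ, EP →L[ℝ] EG) ∞ (θ.localForm p)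
      ((extChartAt 𝓘(ℝ, EP) p).symm (extChartAt 𝓘(ℝ, EP) p p)) := by
    rw [extChartAt_to_inv]
    exact θ.contMDiffAt_localForm p
  exact ((h1.comp _ hs).contDiffAt).differentiableAt (by simp)

/-- The curvature in terms of the Lie bracket of constant vector fields. -/
theorem curvature_inv (θ : CartanConnection (EG := EG) ι B) (p : P)
    (X Y : GroupLieAlgebra 𝓘(ℝ, EG) G) :
    θ.curvature p (θ.inv p X) (θ.inv p Y) =
      ⁅X, Y⁆ - θ.form p
        (mlieBracket 𝓘(ℝ, EP) (fun q => θ.inv q X) (fun q => θ.inv q Y) p) := by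
  let φ := extChartAt 𝓘(ℝ, EP) p
  have ht : φ.target ∈ 𝓝 (φ p) := extChartAt_target_mem_nhds p
  have hext : extDerivOneForm (fun q => (lieToModel EG G).toContinuousLinearMap.comp (θ.form q)) p
      ![θ.inv p X, θ.inv p Y] = -θ.localForm p p
        (mlieBracket 𝓘(ℝ, EP) (fun q => θ.inv q X) (fun q => θ.inv q Y) p) := by
    have hβ : (fun y : EP => ContinuousAlternatingMap.ofSubsingleton ℝ EP EG (0 : Fin 1)
        (((lieToModel EG G).toContinuousLinearMap.comp (θ.form (φ.symm y))).comp
          (mfderiv 𝓘(ℝ, EP) 𝓘(ℝ, EP) φ.symm y))) =ᶠ[𝓝 (φ p)]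
        fun y => ContinuousAlternatingMap.ofSubsingleton ℝ EP EG (0 : Fin 1)
          (θ.localForm p (φ.symm y)) := by
      filter_upwards [ht] with y hy
      exact congrArg _ (θ.localForm_extChartAt_symm p hy).symm
    have h1 := extDeriv_apply_of_const (θ.differentiableAt_localForm p)
      (differentiableAt_chartField (θ.mdifferentiableAt_inv X p))
      (differentiableAt_chartField (θ.mdifferentiableAt_inv Y p))
      (Filter.eventually_of_mem ht fun y hy => θ.localForm_chartField p X hy)
      (Filter.eventually_of_mem ht fun y hy => θ.localForm_chartField p Y hy)
    rw [chartField_self, chartField_self, extChartAt_to_inv,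
      ← mlieBracket_eq_lieBracket_chartField] at h1
    rw [← h1, ← hβ.extDeriv_eq]
    exact congrArg (fun f : EP →L[ℝ] EP => (extDeriv (fun y : EP =>
        ContinuousAlternatingMap.ofSubsingleton ℝ EP EG (0 : Fin 1)
        (((lieToModel EG G).toContinuousLinearMap.comp (θ.form (φ.symm y))).comp
          (mfderiv 𝓘(ℝ, EP) 𝓘(ℝ, EP) φ.symm y))) (φ p)).compContinuousLinearMap f
        ![θ.inv p X, θ.inv p Y]) (mfderiv_extChartAt_self (I := 𝓘(ℝ, EP)) (x := p))
  have hext' := congrArg (lieToModel EG G).symm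
    (hext.trans (congrArg Neg.neg (θ.localForm_self p _)))
  rw [map_neg, ContinuousLinearEquiv.symm_apply_apply] at hext'
  rw [curvature, hext', form_inv, form_inv]
  abel

end CartanConnection

end Curvature

/-! ### Infinitesimal form of a permutation of vector fields, in a vector space. -/

section Flow

open VectorField

/-- Differentiate the relation `hVa` at `s` in the direction `A`. The left side gives a mixed second
derivative of `R`, which by symmetry is the derivative of `Z` along `V (a s)`. The right side gives
the derivative of `V (a s)` along `Z`, plus `V` of the derivative of `a`. The difference is the
bracket. No flow is needed, only a parametrized family of maps with `R (y, s) = y`. -/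
theorem lieBracket_of_fderiv_eq {E F L : Type*} [NormedAddCommGroup E] [NormedSpace ℝ E]
    [NormedAddCommGroup F] [NormedSpace ℝ F] [NormedAddCommGroup L] [NormedSpace ℝ L]
    [FiniteDimensional ℝ L] {R : E × F → E} {y : E} {s : F} (hR : ContDiffAt ℝ 2 R (y, s))
    (hRs : R (y, s) = y) {A : F} {Z : E → E}
    (hZ : ∀ᶠ z in 𝓝 y, Z z = fderiv ℝ (fun t => R (z, t)) s A) {V : L →ₗ[ℝ] E → E}
    (hV : ∀ X, DifferentiableAt ℝ (V X) y) {a : F → L} (ha : DifferentiableAt ℝ a s)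
    (hVa : ∀ᶠ t in 𝓝 s, fderiv ℝ (fun z => R (z, t)) y (V (a s) y) = V (a t) (R (y, t))) :
    lieBracket ℝ Z (V (a s)) y = -V (fderiv ℝ a s A) y := by
  let b := Module.finBasis ℝ L
  have hexp : ∀ (X : L) (z : E), V X z = ∑ i, b.repr X i • V (b i) z := by
    intro X z
    conv_lhs => rw [← b.sum_repr X]
    simp only [map_sum, map_smul, Finset.sum_apply, Pi.smul_apply]
  have hdR : ∀ᶠ q in 𝓝 (y, s), DifferentiableAt ℝ R q :=
    (hR.eventually (by simp)).mono fun q hq => hq.differentiableAt (by simp)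
  have hd2 : DifferentiableAt ℝ (fderiv ℝ R) (y, s) :=
    (hR.fderiv_right (m := 1) (by norm_num)).differentiableAt (by simp)
  have hsymm : IsSymmSndFDerivAt ℝ R (y, s) := hR.isSymmSndFDerivAt (by simp)
  have hl : ∀ z : E, HasFDerivAt (fun z : E => (z, s)) (ContinuousLinearMap.inl ℝ E F) z :=
    fun z => hasFDerivAt_prodMk_left z s
  have hr : ∀ t : F, HasFDerivAt (fun t : F => (y, t)) (ContinuousLinearMap.inr ℝ E F) t :=
    fun t => hasFDerivAt_prodMk_right y t
  have hcl : Filter.Tendsto (fun z : E => (z, s)) (𝓝 y) (𝓝 (y, s)) :=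
    (hl y).continuousAt
  have hcr : Filter.Tendsto (fun t : F => (y, t)) (𝓝 s) (𝓝 (y, s)) :=
    (hr s).continuousAt
  have hZ' : Z =ᶠ[𝓝 y] fun z => fderiv ℝ R (z, s) (0, A) := by
    filter_upwards [hZ, hcl.eventually hdR] with z hz hd
    have h1 : HasFDerivAt (fun t => R (z, t))
        ((fderiv ℝ R (z, s)).comp (ContinuousLinearMap.inr ℝ E F)) s :=
      HasFDerivAt.comp s (f := fun t : F => (z, t)) hd.hasFDerivAt (hasFDerivAt_prodMk_right z s)
    rw [hz, h1.fderiv]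
    rfl
  have hdZ : fderiv ℝ Z y (V (a s) y) = fderiv ℝ (fderiv ℝ R) (y, s) (V (a s) y, 0) (0, A) := by
    have h1 : HasFDerivAt (fun z => fderiv ℝ R (z, s))
      ((fderiv ℝ (fderiv ℝ R) (y, s)).comp (ContinuousLinearMap.inl ℝ E F)) y :=
      HasFDerivAt.comp y (f := fun z : E => (z, s)) hd2.hasFDerivAt (hl y)
    rw [hZ'.fderiv_eq, (h1.clm_apply (hasFDerivAt_const ((0, A) : E × F) y)).fderiv]
    simp
  have hZy : Z y = fderiv ℝ R (y, s) (0, A) := hZ'.self_of_nhds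
  -- Expanding in a basis of `L` separates the dependence on `t` through `a` from that through the
  -- base point, so that only the fields `V (b i)` are differentiated.
  have hV' : (fun t => fderiv ℝ R (y, t) (V (a s) y, 0)) =ᶠ[𝓝 s]
      fun t => ∑ i, b.repr (a t) i • V (b i) (R (y, t)) := by
    filter_upwards [hVa, hcr.eventually hdR] with t ht hd
    have h1 : HasFDerivAt (fun z => R (z, t))
        ((fderiv ℝ R (y, t)).comp (ContinuousLinearMap.inl ℝ E F)) y :=
      HasFDerivAt.comp y (f := fun z : E => (z, t)) hd.hasFDerivAt (hasFDerivAt_prodMk_left y t)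
    rw [← hexp, ← ht, h1.fderiv]
    rfl
  have hleft : fderiv ℝ (fun t => fderiv ℝ R (y, t) (V (a s) y, 0)) s A =
      fderiv ℝ (fderiv ℝ R) (y, s) (0, A) (V (a s) y, 0) := by
    have h1 : HasFDerivAt (fun t => fderiv ℝ R (y, t))
      ((fderiv ℝ (fderiv ℝ R) (y, s)).comp (ContinuousLinearMap.inr ℝ E F)) s :=
      HasFDerivAt.comp s (f := fun t : F => (y, t)) hd2.hasFDerivAt (hr s)
    rw [(h1.clm_apply (hasFDerivAt_const ((V (a s) y, 0) : E × F) s)).fderiv]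
    simp
  have hright : fderiv ℝ (fun t => ∑ i, b.repr (a t) i • V (b i) (R (y, t))) s A =
      fderiv ℝ (V (a s)) y (Z y) + V (fderiv ℝ a s A) y := by
    have hRt : HasFDerivAt (fun t => R (y, t))
        ((fderiv ℝ R (y, s)).comp (ContinuousLinearMap.inr ℝ E F)) s :=
      HasFDerivAt.comp s (f := fun t : F => (y, t)) hdR.self_of_nhds.hasFDerivAt (hr s)
    have hVi : ∀ i, HasFDerivAt (fun t => V (b i) (R (y, t))) ((fderiv ℝ (V (b i)) y).comp
        ((fderiv ℝ R (y, s)).comp (ContinuousLinearMap.inr ℝ E F))) s := by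
      intro i
      refine HasFDerivAt.comp s (f := fun t => R (y, t)) ?_ hRt
      simp only [hRs]
      exact (hV (b i)).hasFDerivAt
    have hci : ∀ i, HasFDerivAt (fun t => b.repr (a t) i)
        ((LinearMap.toContinuousLinearMap (b.coord i)).comp (fderiv ℝ a s)) s := fun i =>
      (LinearMap.toContinuousLinearMap (b.coord i)).hasFDerivAt.comp s ha.hasFDerivAt
    have hVX : HasFDerivAt (V (a s)) (∑ i, b.repr (a s) i • fderiv ℝ (V (b i)) y) y := by
      have h1 : V (a s) = fun z => ∑ i, b.repr (a s) i • V (b i) z := funext fun z => hexp _ _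
      rw [h1]
      exact HasFDerivAt.fun_sum fun i _ => (hV (b i)).hasFDerivAt.const_smul _
    rw [(HasFDerivAt.fun_sum fun i _ => (hci i).fun_smul (hVi i)).fderiv, hVX.fderiv, hZy,
      hexp (fderiv ℝ a s A)]
    simp only [hRs, _root_.sum_apply, _root_.add_apply, Finset.sum_add_distrib]
    rfl
  have hkey := congrArg (fun f : F →L[ℝ] E => f A) hV'.fderiv_eq
  simp only [hleft, hright] at hkey
  rw [lieBracket, hdZ, hsymm.eq, hkey]
  abel

end Flow

/-! ### The same on manifolds, for a smooth family of maps. -/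

section Action

open VectorField

variable {E F L N K : Type*} [NormedAddCommGroup E] [NormedSpace ℝ E]
  [NormedAddCommGroup F] [NormedSpace ℝ F] [NormedAddCommGroup L] [NormedSpace ℝ L]
  [FiniteDimensional ℝ L] [TopologicalSpace N] [ChartedSpace E N] [IsManifold 𝓘(ℝ, E) ∞ N]
  [TopologicalSpace K] [ChartedSpace F K] [IsManifold 𝓘(ℝ, F) ∞ K]

theorem mfderiv_extChartAt_symm_self (p : N) (v : E) :
    (mfderiv 𝓘(ℝ, E) 𝓘(ℝ, E) (extChartAt 𝓘(ℝ, E) p).symm (extChartAt 𝓘(ℝ, E) p p) : E →L[ℝ] E) v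
      = v := by
  have h := mfderivWithin_range_extChartAt_symm (I := 𝓘(ℝ, E)) (x := p)
  rw [modelWithCornersSelf_coe, Set.range_id, mfderivWithin_univ] at h
  exact congrArg (fun f : E →L[ℝ] E => f v) h

variable [CompleteSpace E]

/-- Let `act` be a smooth family of self-maps of `N`, equal to the identity for the parameter `e`,
which permutes the members of a linear family of vector fields according to `a`. Then the bracket
of the velocity field of `act` with a field of the family is minus the field of the family given by
the derivative of `a`. -/
theorem mlieBracket_of_mfderiv_eq {act : N → K → N}
    (hact : ContMDiff (𝓘(ℝ, E).prod 𝓘(ℝ, F)) 𝓘(ℝ, E) ∞ (fun x : N × K => act x.1 x.2))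
    {e : K} (he : ∀ n, act n e = n) (A : TangentSpace 𝓘(ℝ, F) e)
    {Z : ∀ n : N, TangentSpace 𝓘(ℝ, E) n}
    (hZ : ∀ n, (Z n : E) = mfderiv 𝓘(ℝ, F) 𝓘(ℝ, E) (act n) e A)
    {Y : L →ₗ[ℝ] ∀ n : N, TangentSpace 𝓘(ℝ, E) n} {p : N}
    (hY : ∀ X, MDifferentiableAt 𝓘(ℝ, E) (𝓘(ℝ, E)).tangent
      (fun n => (⟨n, Y X n⟩ : TangentBundle 𝓘(ℝ, E) N)) p)
    {a : K → L} (ha : MDifferentiableAt 𝓘(ℝ, F) 𝓘(ℝ, L) a e)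
    (hYa : ∀ h, mfderiv 𝓘(ℝ, E) 𝓘(ℝ, E) (fun n => act n h) p (Y (a e) p) = Y (a h) (act p h)) :
    mlieBracket 𝓘(ℝ, E) Z (Y (a e)) p = -Y (mfderiv 𝓘(ℝ, F) 𝓘(ℝ, L) a e A) p := by
  let φ := extChartAt 𝓘(ℝ, E) p
  let ψ := extChartAt 𝓘(ℝ, F) e
  let R : E × F → E := fun q => φ (act (φ.symm q.1) (ψ.symm q.2))
  let V : L →ₗ[ℝ] E → E :=
    { toFun := fun X => chartField (Y X) p
      map_add' := fun X X' => by funext z; simp only [chartField, map_add, Pi.add_apply]; rfl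
      map_smul' := fun c X => by
        funext z; simp only [chartField, map_smul, Pi.smul_apply]; rfl }
  have hφe : φ.symm (φ p) = p := extChartAt_to_inv p
  have hψe : ψ.symm (ψ e) = e := extChartAt_to_inv e
  have hφt : φ.target ∈ 𝓝 (φ p) := extChartAt_target_mem_nhds p
  have hφs : ContMDiffAt 𝓘(ℝ, E) 𝓘(ℝ, E) ∞ φ.symm (φ p) :=
    (contMDiffOn_extChartAt_symm p).contMDiffAt hφt
  have hψs : ContMDiffAt 𝓘(ℝ, F) 𝓘(ℝ, F) ∞ ψ.symm (ψ e) :=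
    (contMDiffOn_extChartAt_symm e).contMDiffAt (extChartAt_target_mem_nhds e)
  have hact1 : ∀ h, ContMDiff 𝓘(ℝ, E) 𝓘(ℝ, E) ∞ (fun n => act n h) := fun h =>
    hact.comp (contMDiff_id.prodMk contMDiff_const)
  have hact2 : ∀ n, ContMDiff 𝓘(ℝ, F) 𝓘(ℝ, E) ∞ (act n) := fun n =>
    hact.comp (contMDiff_const.prodMk contMDiff_id)
  have hsource : ∀ q ∈ φ.source, MDifferentiableAt 𝓘(ℝ, E) 𝓘(ℝ, E) φ q := fun q hq =>
    mdifferentiableAt_extChartAt (by rwa [← extChartAt_source 𝓘(ℝ, E)])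
  have hR : ContDiffAt ℝ 2 R (φ p, ψ e) := by
    have h0 : act (φ.symm (φ p)) (ψ.symm (ψ e)) = p := by rw [hψe, he, hφe]
    have h1 : ContMDiffAt 𝓘(ℝ, E × F) (𝓘(ℝ, E).prod 𝓘(ℝ, F)) ∞
        (fun q : E × F => (φ.symm q.1, ψ.symm q.2)) (φ p, ψ e) :=
      ContMDiffAt.prodMk
        (ContMDiffAt.comp (φ p, ψ e) (g := φ.symm) (f := Prod.fst) hφs
          contDiffAt_fst.contMDiffAt)
        (ContMDiffAt.comp (φ p, ψ e) (g := ψ.symm) (f := Prod.snd) hψs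
          contDiffAt_snd.contMDiffAt)
    have h2 : ContMDiffAt 𝓘(ℝ, E) 𝓘(ℝ, E) ∞ φ (act (φ.symm (φ p)) (ψ.symm (ψ e))) := by
      rw [h0]
      exact contMDiffAt_extChartAt
    have h3 := (h2.comp (φ p, ψ e) (hact.contMDiffAt.comp (φ p, ψ e) h1)).contDiffAt
    exact h3.of_le ENat.LEInfty.out
  have hRs : R (φ p, ψ e) = φ p := by
    simp only [R]
    rw [hψe, he, hφe]
  have hZ' : ∀ᶠ z in 𝓝 (φ p), chartField Z p z = fderiv ℝ (fun t => R (z, t)) (ψ e) A := by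
    filter_upwards [hφt] with z hz
    have hs : act (φ.symm z) (ψ.symm (ψ e)) ∈ φ.source := by
      rw [hψe, he]
      exact φ.map_target hz
    have h1 := mfderiv_comp_apply_of_eq (I := 𝓘(ℝ, F)) (I' := 𝓘(ℝ, E)) (I'' := 𝓘(ℝ, E))
      (g := φ) (f := fun t => act (φ.symm z) (ψ.symm t)) (ψ e) (hsource _ (φ.map_target hz))
      (((hact2 (φ.symm z)).contMDiffAt.comp (ψ e) hψs).mdifferentiableAt (by simp))
      (by rw [hψe, he]) A
    have h2 := mfderiv_comp_apply_of_eq (I := 𝓘(ℝ, F)) (I' := 𝓘(ℝ, F)) (I'' := 𝓘(ℝ, E))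
      (g := act (φ.symm z)) (f := ψ.symm) (ψ e) ((hact2 _).mdifferentiableAt (by simp))
      (hψs.mdifferentiableAt (by simp)) hψe A
    have h3 : mfderiv 𝓘(ℝ, F) 𝓘(ℝ, E) (fun t => act (φ.symm z) (ψ.symm t)) (ψ e) A =
        Z (φ.symm z) := by
      refine h2.trans (Eq.trans ?_ (hZ (φ.symm z)).symm)
      exact congrArg (mfderiv 𝓘(ℝ, F) 𝓘(ℝ, E) (act (φ.symm z)) e)
        (mfderiv_extChartAt_symm_self (E := F) e A)
    rw [← mfderiv_eq_fderiv]
    refine Eq.trans ?_ h1.symm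
    exact congrArg (mfderiv 𝓘(ℝ, E) 𝓘(ℝ, E) φ (φ.symm z)) h3.symm
  have ha' : DifferentiableAt ℝ (fun t => a (ψ.symm t)) (ψ e) := by
    have h1 : MDifferentiableAt 𝓘(ℝ, F) 𝓘(ℝ, L) a (ψ.symm (ψ e)) := by rwa [hψe]
    exact (h1.comp (ψ e) (hψs.mdifferentiableAt (by simp))).differentiableAt
  have hfa : fderiv ℝ (fun t => a (ψ.symm t)) (ψ e) A = mfderiv 𝓘(ℝ, F) 𝓘(ℝ, L) a e A := by
    rw [← mfderiv_eq_fderiv]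
    have h1 := mfderiv_comp_apply_of_eq (I := 𝓘(ℝ, F)) (I' := 𝓘(ℝ, F)) (I'' := 𝓘(ℝ, L))
      (g := a) (f := ψ.symm) (ψ e) ha (hψs.mdifferentiableAt (by simp)) hψe A
    refine h1.trans ?_
    exact congrArg (mfderiv 𝓘(ℝ, F) 𝓘(ℝ, L) a e) (mfderiv_extChartAt_symm_self (E := F) e A)
  have hVa : ∀ᶠ t in 𝓝 (ψ e), fderiv ℝ (fun z => R (z, t)) (φ p)
      (V (a (ψ.symm (ψ e))) (φ p)) = V (a (ψ.symm t)) (R (φ p, t)) := by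
    have hc : Filter.Tendsto (fun t => act p (ψ.symm t)) (𝓝 (ψ e)) (𝓝 p) := by
      have h1 := ((hact2 p).contMDiffAt.comp (ψ e) hψs).continuousAt
      have h2 : (act p ∘ ψ.symm) (ψ e) = p := by rw [Function.comp_apply, hψe, he]
      rw [ContinuousAt, h2] at h1
      exact h1
    filter_upwards [hc.eventually (extChartAt_source_mem_nhds (I := 𝓘(ℝ, E)) p)] with t ht
    have h1 := mfderiv_comp_apply_of_eq (I := 𝓘(ℝ, E)) (I' := 𝓘(ℝ, E)) (I'' := 𝓘(ℝ, E))
      (g := φ) (f := fun z => act (φ.symm z) (ψ.symm t)) (φ p) (hsource _ ht)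
      (((hact1 (ψ.symm t)).contMDiffAt.comp (φ p) hφs).mdifferentiableAt (by simp))
      (by rw [hφe]) (Y (a e) p)
    have h2 := mfderiv_comp_apply_of_eq (I := 𝓘(ℝ, E)) (I' := 𝓘(ℝ, E)) (I'' := 𝓘(ℝ, E))
      (g := fun n => act n (ψ.symm t)) (f := φ.symm) (φ p)
      ((hact1 _).mdifferentiableAt (by simp)) (hφs.mdifferentiableAt (by simp)) hφe (Y (a e) p)
    have h3 : mfderiv 𝓘(ℝ, E) 𝓘(ℝ, E) (fun z => act (φ.symm z) (ψ.symm t)) (φ p) (Y (a e) p) =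
        Y (a (ψ.symm t)) (act p (ψ.symm t)) := by
      refine h2.trans (Eq.trans ?_ (hYa (ψ.symm t)))
      exact congrArg (mfderiv 𝓘(ℝ, E) 𝓘(ℝ, E) (fun n => act n (ψ.symm t)) p)
        (mfderiv_extChartAt_symm_self (E := E) p (Y (a e) p))
    have h4 : V (a (ψ.symm (ψ e))) (φ p) = Y (a e) p := by
      rw [hψe]
      exact chartField_self _ p
    have h5 : V (a (ψ.symm t)) (R (φ p, t)) = mfderiv 𝓘(ℝ, E) 𝓘(ℝ, E) φ (act p (ψ.symm t))
        (Y (a (ψ.symm t)) (act p (ψ.symm t))) := by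
      have h6 : R (φ p, t) = φ (act p (ψ.symm t)) := by
        simp only [R]
        rw [hφe]
      rw [h6]
      exact chartField_apply _ ht
    rw [← mfderiv_eq_fderiv, h4, h5]
    exact h1.trans (congrArg (mfderiv 𝓘(ℝ, E) 𝓘(ℝ, E) φ (act p (ψ.symm t))) h3)
  have key := lieBracket_of_fderiv_eq hR hRs hZ' (V := V)
    (fun X => differentiableAt_chartField (hY X)) ha' hVa
  rw [hfa] at key
  rw [mlieBracket_eq_lieBracket_chartField]
  simp only [hψe] at key
  refine key.trans (congrArg Neg.neg ?_)
  exact chartField_self _ p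

end Action

/-! ### Equivariance and horizontality of the curvature. -/

section Horizontality

open VectorField Bundle

variable {EG EH EM EP : Type*}
  [NormedAddCommGroup EG] [NormedSpace ℝ EG]
  [NormedAddCommGroup EH] [NormedSpace ℝ EH]
  [NormedAddCommGroup EM] [NormedSpace ℝ EM]
  [NormedAddCommGroup EP] [NormedSpace ℝ EP]
  {G H M P : Type*}
  [Group G] [TopologicalSpace G] [ChartedSpace EG G]
  [Group H] [TopologicalSpace H] [ChartedSpace EH H]
  [TopologicalSpace M] [ChartedSpace EM M]
  [TopologicalSpace P] [ChartedSpace EP P]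

theorem Ad_one (X : GroupLieAlgebra 𝓘(ℝ, EG) G) : Ad (1 : G) X = X := by
  have h : (fun x : G => 1 * x * 1⁻¹) = id := by ext x; simp
  rw [Ad, h, mfderiv_id]
  rfl

theorem mulInvariantVectorField_one (X : GroupLieAlgebra 𝓘(ℝ, EG) G) :
    (mulInvariantVectorField X (1 : G) : EG) = X := by
  have h : (fun x : G => 1 * x) = id := by ext x; simp
  rw [mulInvariantVectorField, h, mfderiv_id]
  rfl

section

variable [LieGroup 𝓘(ℝ, EG) ∞ G]

/-- Right translation by `k` is conjugation by `k⁻¹` followed by left translation: `x k = k (k⁻¹ x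
k)`. The base point is kept as `1 * k` to match the action `g * ι h` at `g = 1`. -/
theorem mfderiv_mul_right_one (k : G) (X : GroupLieAlgebra 𝓘(ℝ, EG) G) :
    (mfderiv 𝓘(ℝ, EG) 𝓘(ℝ, EG) (fun x : G => x * k) 1 X : EG) =
      mulInvariantVectorField (Ad k⁻¹ X) (1 * k) := by
  have h : (fun x : G => x * k) = (fun x => (1 * k) * x) ∘ fun x => k⁻¹ * x * k⁻¹⁻¹ := by
    ext x; simp [mul_assoc]
  have hc : ContMDiff 𝓘(ℝ, EG) 𝓘(ℝ, EG) ∞ (fun x : G => k⁻¹ * x * k⁻¹⁻¹) :=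
    (contMDiff_mul_right (a := k⁻¹⁻¹)).comp (contMDiff_mul_left (a := k⁻¹))
  have h1 := mfderiv_comp_apply_of_eq (I := 𝓘(ℝ, EG)) (I' := 𝓘(ℝ, EG)) (I'' := 𝓘(ℝ, EG))
    (1 : G) (g := fun x => (1 * k) * x) (f := fun x => k⁻¹ * x * k⁻¹⁻¹) (y := 1)
    ((contMDiff_mul_left (I := 𝓘(ℝ, EG)) (n := ∞)).mdifferentiableAt (by simp))
    (hc.mdifferentiableAt (by simp)) (by simp) X
  rw [h]
  exact h1

theorem mulInvariantVectorField_lieMap {ι : H →* G} (hι : MDifferentiableAt 𝓘(ℝ, EH) 𝓘(ℝ, EG) ι 1)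
    (A : GroupLieAlgebra 𝓘(ℝ, EH) H) (g : G) :
    (mulInvariantVectorField (lieMap (EG := EG) (EH := EH) ι A) g : EG) =
      mfderiv 𝓘(ℝ, EH) 𝓘(ℝ, EG) (fun h => g * ι h) 1 A :=
  (mfderiv_comp_apply_of_eq (I := 𝓘(ℝ, EH)) (I' := 𝓘(ℝ, EG)) (I'' := 𝓘(ℝ, EG))
    (1 : H) (g := fun x => g * x) (f := ι) (y := 1)
    ((contMDiff_mul_left (I := 𝓘(ℝ, EG)) (n := ∞)).mdifferentiableAt (by simp))
    hι (map_one ι) A).symm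

end

variable {B : PrincipalBundle EH EM EP H M P} {ι : H →* G}

namespace PrincipalBundle

variable [IsManifold 𝓘(ℝ, EP) ∞ P] [IsManifold 𝓘(ℝ, EH) ∞ H]

/-- The curve of vectors is the tangent map of the whole action applied to `(v, 0_h)`. It serves to
show that `h ↦ Ad (ι h⁻¹) X` is differentiable. -/
theorem contMDiff_mfderiv_act (B : PrincipalBundle EH EM EP H M P) (p : P)
    (v : TangentSpace 𝓘(ℝ, EP) p) :
    ContMDiff 𝓘(ℝ, EH) (𝓘(ℝ, EP)).tangent ∞ (fun h : H => (⟨B.act p h,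
      mfderiv 𝓘(ℝ, EP) 𝓘(ℝ, EP) (fun q => B.act q h) p v⟩ : TangentBundle 𝓘(ℝ, EP) P)) := by
  have h1 : ContMDiff 𝓘(ℝ, EH) ((𝓘(ℝ, EP)).tangent.prod (𝓘(ℝ, EH)).tangent) ∞
      (fun h : H => ((⟨p, v⟩ : TangentBundle 𝓘(ℝ, EP) P),
        (TotalSpace.mk' EH h 0 : TangentBundle 𝓘(ℝ, EH) H))) :=
    contMDiff_const.prodMk (contMDiff_zeroSection _ _)
  have h2 := (contMDiff_equivTangentBundleProd_symm (I := 𝓘(ℝ, EP)) (M := P)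
    (I' := 𝓘(ℝ, EH)) (M' := H) (n := ∞)).comp h1
  have h3 := (B.contMDiff_act.contMDiff_tangentMap (m := ∞) le_rfl).comp h2
  convert h3 using 1
  funext h
  refine congrArg (TotalSpace.mk' EP (E := TangentSpace 𝓘(ℝ, EP)) (B.act p h)) ?_
  have h4 := mfderiv_prod_eq_add_apply (I := 𝓘(ℝ, EP)) (I' := 𝓘(ℝ, EH)) (I'' := 𝓘(ℝ, EP))
    (f := fun x : P × H => B.act x.1 x.2) (p := (p, h)) (v := (v, (0 : EH)))
    (B.contMDiff_act.mdifferentiableAt (by simp))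
  refine Eq.trans ?_ h4.symm
  exact (add_zero _).symm.trans (congrArg _ (map_zero _).symm)

end PrincipalBundle

namespace CartanConnection

variable [IsManifold 𝓘(ℝ, EP) ∞ P]

theorem inv_congr (θ : CartanConnection (EG := EG) ι B) {p q : P} (h : p = q)
    (X : GroupLieAlgebra 𝓘(ℝ, EG) G) : (θ.inv p X : EP) = θ.inv q X := by
  subst h
  rfl

theorem inv_lieMap (θ : CartanConnection (EG := EG) ι B) (p : P)
    (A : GroupLieAlgebra 𝓘(ℝ, EH) H) :
    (θ.inv p (lieMap (EG := EG) (EH := EH) ι A) : EP) =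
      mfderiv 𝓘(ℝ, EH) 𝓘(ℝ, EP) (fun h => B.act p h) 1 A := by
  rw [← θ.inv_congr (B.act_one p), ← θ.fundamental p A]
  exact θ.inv_form _ _

theorem mfderiv_act_inv (θ : CartanConnection (EG := EG) ι B) (p : P) (h : H)
    (X : GroupLieAlgebra 𝓘(ℝ, EG) G) :
    mfderiv 𝓘(ℝ, EP) 𝓘(ℝ, EP) (fun q => B.act q h) p (θ.inv p X) =
      θ.inv (B.act p h) (Ad (ι h⁻¹) X) := by
  rw [← θ.form_inv p X, ← θ.equivariant, form_inv, inv_form]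

variable [FiniteDimensional ℝ EP] [LieGroup 𝓘(ℝ, EG) ∞ G] [LieGroup 𝓘(ℝ, EH) ∞ H]
  [FiniteDimensional ℝ EG] [CompleteSpace EG]

/-- Right translations permute the constant fields on `P`, and the left-invariant fields on `G`,
through the same function `a h = Ad (ι h⁻¹) X`. Both brackets are thus minus the field given by the
derivative of `a` at `1`. Comparing them avoids a separate computation of the derivative of `Ad`. -/
theorem mlieBracket_inv_lieMap (θ : CartanConnection (EG := EG) ι B)
    (hι : ContMDiff 𝓘(ℝ, EH) 𝓘(ℝ, EG) ∞ ι) (p : P) (A : GroupLieAlgebra 𝓘(ℝ, EH) H)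
    (X : GroupLieAlgebra 𝓘(ℝ, EG) G) :
    mlieBracket 𝓘(ℝ, EP) (fun q => θ.inv q (lieMap (EG := EG) (EH := EH) ι A))
        (fun q => θ.inv q X) p =
      θ.inv p ⁅lieMap (EG := EG) (EH := EH) ι A, X⁆ := by
  let a : H → EG := fun h => lieToModel EG G (Ad (ι h⁻¹) X)
  have ha1 : (lieToModel EG G).symm (a 1) = X := by
    simp only [a, inv_one, map_one, Ad_one, ContinuousLinearEquiv.symm_apply_apply]
  have ha : MDifferentiableAt 𝓘(ℝ, EH) 𝓘(ℝ, EG) a 1 := by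
    -- By equivariance `a h` is the connection form evaluated on the translate of `θ.inv p X` by
    -- `h`, hence differentiable in `h`.
    have h1 := θ.contMDiff_form.comp (B.contMDiff_mfderiv_act p (θ.inv p X))
    have h2 : a = (fun v : TangentBundle 𝓘(ℝ, EP) P => lieToModel EG G (θ.form v.proj v.snd)) ∘
        (fun h : H => (⟨B.act p h, mfderiv 𝓘(ℝ, EP) 𝓘(ℝ, EP) (fun q => B.act q h) p
          (θ.inv p X)⟩ : TangentBundle 𝓘(ℝ, EP) P)) := by
      funext h
      simp only [a, Function.comp_apply]
      rw [mfderiv_act_inv, form_inv]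
    rw [h2]
    exact h1.mdifferentiableAt (by simp)
  have hcomplete : CompleteSpace EP := FiniteDimensional.complete ℝ EP
  let Y : EG →ₗ[ℝ] ∀ q : P, TangentSpace 𝓘(ℝ, EP) q :=
    LinearMap.pi fun q => θ.inv q ∘ₗ (lieToModel EG G).symm.toLinearMap
  have hP := mlieBracket_of_mfderiv_eq B.contMDiff_act B.act_one A
    (Z := fun q => θ.inv q (lieMap (EG := EG) (EH := EH) ι A)) (fun q => θ.inv_lieMap q A)
    (Y := Y) (p := p)
    (fun X => θ.mdifferentiableAt_inv _ p) ha
    (fun h => by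
      change mfderiv 𝓘(ℝ, EP) 𝓘(ℝ, EP) (fun q => B.act q h) p
        (θ.inv p ((lieToModel EG G).symm (a 1))) = θ.inv (B.act p h) (Ad (ι h⁻¹) X)
      rw [ha1, mfderiv_act_inv])
  let Y' : EG →ₗ[ℝ] ∀ g : G, TangentSpace 𝓘(ℝ, EG) g :=
    LinearMap.pi fun g => (mfderiv 𝓘(ℝ, EG) 𝓘(ℝ, EG) (g * ·) (1 : G)).toLinearMap ∘ₗ
      (lieToModel EG G).symm.toLinearMap
  -- At the identity of `G` the bracket of left-invariant fields is the Lie algebra bracket, so this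
  -- identifies the derivative of `a` along `A` with `-⁅lieMap ι A, X⁆`.
  have hG := mlieBracket_of_mfderiv_eq (act := fun (g : G) (h : H) => g * ι h) (p := (1 : G))
    (contMDiff_fst.mul (hι.comp contMDiff_snd)) (e := 1) (fun g => by simp) A
    (Z := mulInvariantVectorField (lieMap (EG := EG) (EH := EH) ι A))
    (fun g => mulInvariantVectorField_lieMap (hι.mdifferentiableAt (by simp)) A g)
    (Y := Y') (fun X => mdifferentiableAt_mulInvariantVectorField _) ha
    (fun h => by
      have h1 := mfderiv_mul_right_one (ι h) X
      rw [← map_inv] at h1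
      refine Eq.trans ?_ h1
      refine congrArg (mfderiv 𝓘(ℝ, EG) 𝓘(ℝ, EG) (fun x : G => x * ι h) 1) ?_
      exact (mulInvariantVectorField_one _).trans ha1)
  have hbr : ⁅lieMap (EG := EG) (EH := EH) ι A, X⁆ =
      -(lieToModel EG G).symm (mfderiv 𝓘(ℝ, EH) 𝓘(ℝ, EG) a 1 A) := by
    rw [GroupLieAlgebra.bracket_def]
    have h1 : Y' (a 1) = mulInvariantVectorField X := by
      rw [← ha1]
      rfl
    rw [h1] at hG
    refine hG.trans (congrArg Neg.neg ?_)
    exact mulInvariantVectorField_one _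
  have h1 : Y (a 1) = fun q => θ.inv q X := by
    rw [← ha1]
    rfl
  rw [h1] at hP
  rw [hP, hbr, map_neg]
  rfl

/-- The curvature is horizontal. -/
theorem curvature_inv_lieMap (θ : CartanConnection (EG := EG) ι B)
    (hι : ContMDiff 𝓘(ℝ, EH) 𝓘(ℝ, EG) ∞ ι) (p : P) (A : GroupLieAlgebra 𝓘(ℝ, EH) H)
    (X : GroupLieAlgebra 𝓘(ℝ, EG) G) :
    θ.curvature p (θ.inv p (lieMap (EG := EG) (EH := EH) ι A)) (θ.inv p X) = 0 := by
  rw [curvature_inv, mlieBracket_inv_lieMap θ hι, form_inv, sub_self]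

end CartanConnection

end Horizontality

/-! ### The Bianchi identity from the Jacobi identity of constant fields. -/

section Bianchi

open VectorField Bundle

theorem mlieBracket_sum_right {E N κ : Type*} [NormedAddCommGroup E] [NormedSpace ℝ E]
    [CompleteSpace E] [TopologicalSpace N] [ChartedSpace E N] [IsManifold 𝓘(ℝ, E) ∞ N]
    {V : ∀ n : N, TangentSpace 𝓘(ℝ, E) n} {W : κ → ∀ n : N, TangentSpace 𝓘(ℝ, E) n} {p : N}
    (s : Finset κ) (hW : ∀ i, MDifferentiableAt 𝓘(ℝ, E) (𝓘(ℝ, E)).tangent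
      (fun n => (⟨n, W i n⟩ : TangentBundle 𝓘(ℝ, E) N)) p) :
    mlieBracket 𝓘(ℝ, E) V (∑ i ∈ s, W i) p = ∑ i ∈ s, mlieBracket 𝓘(ℝ, E) V (W i) p := by
  classical
  induction s using Finset.induction_on with
  | empty =>
    rw [Finset.sum_empty, Finset.sum_empty, mlieBracket_zero_right]
    rfl
  | insert i s hi ih =>
    have hs := MDifferentiableAt.sum_section (s := s) (t := W) fun i _ => hW i
    rw [Finset.sum_insert hi, Finset.sum_insert hi, mlieBracket_add_right (hW i), ih]
    convert hs using 3
    exact Finset.sum_apply _ _ _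

variable {EG EH EM EP : Type*}
  [NormedAddCommGroup EG] [NormedSpace ℝ EG]
  [NormedAddCommGroup EH] [NormedSpace ℝ EH]
  [NormedAddCommGroup EM] [NormedSpace ℝ EM]
  [NormedAddCommGroup EP] [NormedSpace ℝ EP]
  {G H M P : Type*}
  [Group G] [TopologicalSpace G] [ChartedSpace EG G]
  [Group H] [TopologicalSpace H] [ChartedSpace EH H]
  [TopologicalSpace M] [ChartedSpace EM M]
  [TopologicalSpace P] [ChartedSpace EP P]
  [IsManifold 𝓘(ℝ, EP) ∞ P] {ι : H →* G} {B : PrincipalBundle EH EM EP H M P}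

namespace CartanConnection

variable [CompleteSpace EG] [LieGroup 𝓘(ℝ, EG) ∞ G]

/-- The curvature in the coframing given by a Cartan connection. -/
def curvatureFunction (θ : CartanConnection (EG := EG) ι B) (p : P) :
    GroupLieAlgebra 𝓘(ℝ, EG) G →ₗ[ℝ] GroupLieAlgebra 𝓘(ℝ, EG) G →ₗ[ℝ]
      GroupLieAlgebra 𝓘(ℝ, EG) G :=
  LinearMap.mk₂ ℝ (fun X Y => θ.curvature p (θ.inv p X) (θ.inv p Y))
    (fun X X' Y => by simp [curvature_add_left]) (fun c X Y => by simp [curvature_smul_left])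
    (fun X Y Y' => by simp [curvature_add_right]) (fun c X Y => by simp [curvature_smul_right])

theorem curvatureFunction_apply (θ : CartanConnection (EG := EG) ι B) (p : P)
    (X Y : GroupLieAlgebra 𝓘(ℝ, EG) G) :
    θ.curvatureFunction p X Y = θ.curvature p (θ.inv p X) (θ.inv p Y) := rfl

theorem curvatureFunction_swap (θ : CartanConnection (EG := EG) ι B) (p : P)
    (X Y : GroupLieAlgebra 𝓘(ℝ, EG) G) :
    θ.curvatureFunction p X Y = -θ.curvatureFunction p Y X :=
  θ.curvature_swap p _ _

variable [FiniteDimensional ℝ EP]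

theorem mlieBracket_inv (θ : CartanConnection (EG := EG) ι B)
    (X Y : GroupLieAlgebra 𝓘(ℝ, EG) G) (p : P) :
    mlieBracket 𝓘(ℝ, EP) (fun q => θ.inv q X) (fun q => θ.inv q Y) p =
      θ.inv p (⁅X, Y⁆ - θ.curvatureFunction p X Y) := by
  rw [curvatureFunction_apply, curvature_inv, sub_sub_cancel, inv_form]

theorem contMDiff_curvatureFunction (θ : CartanConnection (EG := EG) ι B)
    (X Y : GroupLieAlgebra 𝓘(ℝ, EG) G) :
    ContMDiff 𝓘(ℝ, EP) 𝓘(ℝ, EG) ∞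
      (fun p => lieToModel EG G (θ.curvatureFunction p X Y)) := by
  have hcomplete : CompleteSpace EP := FiniteDimensional.complete ℝ EP
  have h1 : ContMDiff 𝓘(ℝ, EP) (𝓘(ℝ, EP)).tangent ∞ (fun p => (⟨p,
      mlieBracket 𝓘(ℝ, EP) (fun q => θ.inv q X) (fun q => θ.inv q Y) p⟩ :
        TangentBundle 𝓘(ℝ, EP) P)) := by
    have : IsManifold 𝓘(ℝ, EP) (((⊤ : ℕ∞) : ℕ∞ω) + 1) P := ‹IsManifold 𝓘(ℝ, EP) ∞ P›
    refine ContDiff.mlieBracket_vectorField (m := ⊤) (n := ⊤) (θ.contMDiff_inv X)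
      (θ.contMDiff_inv Y) ?_
    simp
  have h2 := (contMDiff_const (c := lieToModel EG G ⁅X, Y⁆)).sub (θ.contMDiff_form.comp h1)
  convert h2 using 2 with p
  rw [curvatureFunction_apply, curvature_inv, map_sub]
  rfl

theorem contMDiff_dual_curvatureFunction [FiniteDimensional ℝ EG]
    (θ : CartanConnection (EG := EG) ι B) (v : Module.Dual ℝ (GroupLieAlgebra 𝓘(ℝ, EG) G))
    (X Y : GroupLieAlgebra 𝓘(ℝ, EG) G) :
    ContMDiff 𝓘(ℝ, EP) 𝓘(ℝ, ℝ) ∞ (fun p => v (θ.curvatureFunction p X Y)) :=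
  (LinearMap.toContinuousLinearMap
    (v ∘ₗ (lieToModel EG G).symm.toLinearMap)).contMDiff.comp (θ.contMDiff_curvatureFunction X Y)

variable [FiniteDimensional ℝ EG]

/-- The Leibniz rule, applied after expanding `f` in a basis, reduces to brackets of constant
fields. It is needed because the bracket of two constant fields is constant only up to curvature. -/
theorem mlieBracket_inv_comp (θ : CartanConnection (EG := EG) ι B)
    (X : GroupLieAlgebra 𝓘(ℝ, EG) G) {f : P → EG} {p : P}
    (hf : MDifferentiableAt 𝓘(ℝ, EP) 𝓘(ℝ, EG) f p) :
    mlieBracket 𝓘(ℝ, EP) (fun q => θ.inv q X)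
        (fun q => θ.inv q ((lieToModel EG G).symm (f q))) p =
      θ.inv p ((lieToModel EG G).symm (mfderiv 𝓘(ℝ, EP) 𝓘(ℝ, EG) f p (θ.inv p X)) +
        (⁅X, (lieToModel EG G).symm (f p)⁆ -
          θ.curvatureFunction p X ((lieToModel EG G).symm (f p)))) := by
  have hcomplete : CompleteSpace EP := FiniteDimensional.complete ℝ EP
  let b := Module.finBasis ℝ EG
  let e := fun i => (lieToModel EG G).symm (b i)
  have hcoord : ∀ i, MDifferentiableAt 𝓘(ℝ, EP) 𝓘(ℝ, ℝ) (fun q => b.coord i (f q)) p := fun i =>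
    ((LinearMap.toContinuousLinearMap (b.coord i)).mdifferentiable _).comp p hf
  have hfield : (fun q => θ.inv q ((lieToModel EG G).symm (f q))) =
      ∑ i, (fun q => b.coord i (f q)) • fun q => θ.inv q (e i) := by
    funext q
    conv_lhs => rw [← b.sum_repr (f q)]
    rw [Finset.sum_apply]
    simp only [map_sum, map_smul]
    rfl
  have hderiv : ∀ i, mvfderiv 𝓘(ℝ, EP) (fun q => b.coord i (f q)) p (θ.inv p X) =
      b.coord i (mfderiv 𝓘(ℝ, EP) 𝓘(ℝ, EG) f p (θ.inv p X)) := by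
    intro i
    have h1 := mfderiv_comp_apply (I := 𝓘(ℝ, EP)) (I' := 𝓘(ℝ, EG)) (I'' := 𝓘(ℝ, ℝ)) p
      (g := LinearMap.toContinuousLinearMap (b.coord i))
      ((LinearMap.toContinuousLinearMap (b.coord i)).mdifferentiable _) hf (θ.inv p X)
    refine h1.trans ?_
    rw [ContinuousLinearMap.mfderiv_eq]
    rfl
  have hexp : ∀ Y : EG, (lieToModel EG G).symm Y = ∑ i, b.coord i Y • e i := by
    intro Y
    conv_lhs => rw [← b.sum_repr Y]
    rw [map_sum]
    simp only [map_smul]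
    rfl
  rw [hfield, mlieBracket_sum_right]
  · have : ∀ i, mlieBracket 𝓘(ℝ, EP) (fun q => θ.inv q X)
        ((fun q => b.coord i (f q)) • fun q => θ.inv q (e i)) p =
        θ.inv p (b.coord i (mfderiv 𝓘(ℝ, EP) 𝓘(ℝ, EG) f p (θ.inv p X)) • e i +
          (⁅X, b.coord i (f p) • e i⁆ - θ.curvatureFunction p X (b.coord i (f p) • e i))) := by
      intro i
      rw [mlieBracket_smul_right (hcoord i) (θ.mdifferentiableAt_inv _ p), mlieBracket_inv, hderiv]
      simp only [map_add, map_smul, map_sub, lie_smul, smul_sub]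
    simp only [this]
    rw [← map_sum, Finset.sum_add_distrib, Finset.sum_sub_distrib, ← lie_sum, ← map_sum, ← hexp]
    exact congrArg (fun t => θ.inv p (t + _)) (hexp _).symm
  · intro i
    exact (hcoord i).smul_section (θ.mdifferentiableAt_inv _ p)

theorem dual_form_mlieBracket_mlieBracket (θ : CartanConnection (EG := EG) ι B)
    (v : Module.Dual ℝ (GroupLieAlgebra 𝓘(ℝ, EG) G)) (X Y Z : GroupLieAlgebra 𝓘(ℝ, EG) G)
    (p : P) :
    v (θ.form p (mlieBracket 𝓘(ℝ, EP) (fun q => θ.inv q X)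
      (mlieBracket 𝓘(ℝ, EP) (fun q => θ.inv q Y) (fun q => θ.inv q Z)) p)) =
      -θ.covDeriv X (fun q => v (θ.curvatureFunction q Y Z)) p +
        v (⁅X, ⁅Y, Z⁆⁆ - ⁅X, θ.curvatureFunction p Y Z⁆ - θ.curvatureFunction p X ⁅Y, Z⁆ +
          θ.curvatureFunction p X (θ.curvatureFunction p Y Z)) := by
  let f : P → EG := fun q => lieToModel EG G (⁅Y, Z⁆ - θ.curvatureFunction q Y Z)
  have hf : MDifferentiableAt 𝓘(ℝ, EP) 𝓘(ℝ, EG) f p := by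
    have h1 := (contMDiff_const (c := lieToModel EG G ⁅Y, Z⁆)).sub
      (θ.contMDiff_curvatureFunction Y Z)
    refine (h1.mdifferentiableAt (x := p) (by simp)).congr_of_eventuallyEq
      (Filter.Eventually.of_forall fun q => ?_)
    simp only [f, map_sub]
  have hbr : mlieBracket 𝓘(ℝ, EP) (fun q => θ.inv q Y) (fun q => θ.inv q Z) =
      fun q => θ.inv q ((lieToModel EG G).symm (f q)) := by
    funext q
    rw [mlieBracket_inv]
    rfl
  let w := LinearMap.toContinuousLinearMap (v ∘ₗ (lieToModel EG G).symm.toLinearMap)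
  have hd : v ((lieToModel EG G).symm (mfderiv 𝓘(ℝ, EP) 𝓘(ℝ, EG) f p (θ.inv p X))) =
      -θ.covDeriv X (fun q => v (θ.curvatureFunction q Y Z)) p := by
    have h1 := mfderiv_comp_apply (I := 𝓘(ℝ, EP)) (I' := 𝓘(ℝ, EG)) (I'' := 𝓘(ℝ, ℝ)) p
      (g := w) (w.mdifferentiable _) hf (θ.inv p X)
    rw [ContinuousLinearMap.mfderiv_eq] at h1
    refine h1.symm.trans ?_
    have h2 : w ∘ f = (fun _ => v ⁅Y, Z⁆) - fun q => v (θ.curvatureFunction q Y Z) := by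
      funext q
      exact map_sub v _ _
    rw [h2]
    have h3 := mfderiv_sub (I := 𝓘(ℝ, EP)) (z := p)
      (mdifferentiableAt_const (c := v ⁅Y, Z⁆))
      ((θ.contMDiff_dual_curvatureFunction v Y Z).mdifferentiableAt (by simp))
    refine (congrArg (fun g : EP →L[ℝ] ℝ => g (θ.inv p X)) h3).trans ?_
    exact (congrArg₂ HSub.hSub (congrArg (fun g : EP →L[ℝ] ℝ => g (θ.inv p X)) mfderiv_const)
      rfl).trans (zero_sub _)
  rw [hbr, θ.mlieBracket_inv_comp X hf, form_inv, map_add, hd]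
  congr 2
  simp only [f, ContinuousLinearEquiv.symm_apply_apply, map_sub, lie_sub]
  abel

/-- The Bianchi identity. -/
theorem bianchi (θ : CartanConnection (EG := EG) ι B)
    (v : Module.Dual ℝ (GroupLieAlgebra 𝓘(ℝ, EG) G)) (X Y Z : GroupLieAlgebra 𝓘(ℝ, EG) G)
    (p : P) :
    v (θ.curvatureFunction p X ⁅Y, Z⁆ + θ.curvatureFunction p Y ⁅Z, X⁆ +
        θ.curvatureFunction p Z ⁅X, Y⁆ +
      (⁅X, θ.curvatureFunction p Y Z⁆ + ⁅Y, θ.curvatureFunction p Z X⁆ +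
        ⁅Z, θ.curvatureFunction p X Y⁆) -
      (θ.curvatureFunction p X (θ.curvatureFunction p Y Z) +
        θ.curvatureFunction p Y (θ.curvatureFunction p Z X) +
        θ.curvatureFunction p Z (θ.curvatureFunction p X Y))) =
    -(θ.covDeriv X (fun q => v (θ.curvatureFunction q Y Z)) p +
      θ.covDeriv Y (fun q => v (θ.curvatureFunction q Z X)) p +
      θ.covDeriv Z (fun q => v (θ.curvatureFunction q X Y)) p) := by
  have hcomplete : CompleteSpace EP := FiniteDimensional.complete ℝ EP
  have hs : ∀ X, ContMDiffAt 𝓘(ℝ, EP) (𝓘(ℝ, EP)).tangent (minSmoothness ℝ 2)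
      (fun p => (⟨p, θ.inv p X⟩ : TangentBundle 𝓘(ℝ, EP) P)) p := by
    intro X
    refine (θ.contMDiff_inv X).contMDiffAt.of_le ?_
    rw [minSmoothness_of_isRCLikeNormedField]
    exact ENat.LEInfty.out
  -- The Jacobi identity in Leibniz form; the swaps below make it cyclic, and `hjac` cancels the
  -- curvature-free double brackets.
  have hJ := leibniz_identity_mlieBracket_apply (hs X) (hs Y) (hs Z)
  rw [mlieBracket_swap_apply (V := mlieBracket 𝓘(ℝ, EP) _ _)] at hJ
  have hJ' := congrArg (fun t => v (θ.form p t)) hJ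
  simp only [map_add, map_neg, dual_form_mlieBracket_mlieBracket] at hJ'
  have hsw : θ.covDeriv Y (fun q => v (θ.curvatureFunction q X Z)) p =
      -θ.covDeriv Y (fun q => v (θ.curvatureFunction q Z X)) p := by
    have h1 : (fun q => v (θ.curvatureFunction q X Z)) =
        -fun q => v (θ.curvatureFunction q Z X) := by
      funext q
      rw [curvatureFunction_swap, map_neg]
      rfl
    rw [h1, covDeriv, mfderiv_neg]
    rfl
  have hjac : ⁅X, ⁅Y, Z⁆⁆ = -⁅Y, ⁅Z, X⁆⁆ - ⁅Z, ⁅X, Y⁆⁆ := by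
    have := lie_jacobi X Y Z
    rw [← sub_eq_zero, ← this]
    abel
  rw [hsw, θ.curvatureFunction_swap p X Z, ← lie_skew X Z, hjac] at hJ'
  simp only [map_add, map_sub, map_neg, lie_neg] at hJ' ⊢
  linarith

end CartanConnection

end Bianchi

/-! ### The algebras of differential invariants. -/

section Invariants

/-- The coefficients of a linear image of `F` are coefficients of `F`. -/
theorem dual_comp_linearMap_comp_mem {P V V' : Type*} [AddCommGroup V] [Module ℝ V]
    [AddCommGroup V'] [Module ℝ V'] {W : Submodule ℝ V} (F : P → V) (hF : ∀ p, F p ∈ W)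
    (π : W →ₗ[ℝ] V') {S : Set (P → ℝ)} (h : ∀ u : Module.Dual ℝ V, (fun p => u (F p)) ∈ S)
    (v : Module.Dual ℝ V') : (fun p => v (π ⟨F p, hF p⟩)) ∈ S := by
  obtain ⟨u, hu⟩ := LinearMap.exists_extend (v ∘ₗ π)
  have huv : (fun p => u (F p)) = fun p => v (π ⟨F p, hF p⟩) :=
    funext fun p => congrArg (fun f => f ⟨F p, hF p⟩) hu
  exact huv ▸ h u

variable {EG EH EM EP : Type*}
  [NormedAddCommGroup EG] [NormedSpace ℝ EG]
  [NormedAddCommGroup EH] [NormedSpace ℝ EH]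
  [NormedAddCommGroup EM] [NormedSpace ℝ EM]
  [NormedAddCommGroup EP] [NormedSpace ℝ EP]
  {G H M P : Type*}
  [Group G] [TopologicalSpace G] [ChartedSpace EG G]
  [Group H] [TopologicalSpace H] [ChartedSpace EH H]
  [TopologicalSpace M] [ChartedSpace EM M]
  [TopologicalSpace P] [ChartedSpace EP P]

variable (EP P) in
/-- The algebra of smooth real functions on `P`. -/
def smoothFunctions : Subalgebra ℝ (P → ℝ) where
  carrier := {g | ContMDiff 𝓘(ℝ, EP) 𝓘(ℝ, ℝ) ∞ g}
  mul_mem' := fun hf hg => ContMDiff.mul hf hg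
  add_mem' := fun hf hg => ContMDiff.add hf hg
  algebraMap_mem' := fun _ => contMDiff_const

variable [IsManifold 𝓘(ℝ, EP) ∞ P] {ι : H →* G} {B : PrincipalBundle EH EM EP H M P}

namespace CartanConnection

section CovariantDerivative

variable (θ : CartanConnection (EG := EG) ι B) (X : GroupLieAlgebra 𝓘(ℝ, EG) G)

theorem covDeriv_apply (f : P → ℝ) (p : P) :
    θ.covDeriv X f p = mvfderiv 𝓘(ℝ, EP) f p (θ.inv p X) := rfl

theorem covDeriv_algebraMap (c : ℝ) : θ.covDeriv X (algebraMap ℝ (P → ℝ) c) = 0 := by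
  funext p
  have h : mvfderiv 𝓘(ℝ, EP) (algebraMap ℝ (P → ℝ) c) p = 0 := mvfderiv_const c
  rw [covDeriv_apply, h]
  rfl

theorem covDeriv_add {f g : P → ℝ} (hf : ContMDiff 𝓘(ℝ, EP) 𝓘(ℝ, ℝ) ∞ f)
    (hg : ContMDiff 𝓘(ℝ, EP) 𝓘(ℝ, ℝ) ∞ g) :
    θ.covDeriv X (f + g) = θ.covDeriv X f + θ.covDeriv X g := by
  funext p
  rw [covDeriv_apply, mvfderiv_add (hf.mdifferentiableAt (by simp))
    (hg.mdifferentiableAt (by simp))]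
  rfl

theorem covDeriv_mul {f g : P → ℝ} (hf : ContMDiff 𝓘(ℝ, EP) 𝓘(ℝ, ℝ) ∞ f)
    (hg : ContMDiff 𝓘(ℝ, EP) 𝓘(ℝ, ℝ) ∞ g) :
    θ.covDeriv X (f * g) = f * θ.covDeriv X g + g * θ.covDeriv X f := by
  funext p
  rw [covDeriv_apply, mvfderiv_mul (hf.mdifferentiableAt (by simp))
    (hg.mdifferentiableAt (by simp))]
  rfl

variable [FiniteDimensional ℝ EP]

theorem contMDiff_covDeriv {f : P → ℝ} (hf : ContMDiff 𝓘(ℝ, EP) 𝓘(ℝ, ℝ) ∞ f) :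
    ContMDiff 𝓘(ℝ, EP) 𝓘(ℝ, ℝ) ∞ (θ.covDeriv X f) :=
  (contMDiff_snd_tangentBundle_modelSpace ℝ 𝓘(ℝ, ℝ)).comp
    ((hf.contMDiff_tangentMap (m := ∞) le_rfl).comp (θ.contMDiff_inv X))

end CovariantDerivative

variable {V : Type*} [AddCommGroup V] [Module ℝ V]

theorem invariantAlgebra_le (θ : CartanConnection (EG := EG) ι B) {f : P → V}
    {A : Subalgebra ℝ (P → ℝ)} (hA : ∀ X, ∀ g ∈ A, θ.covDeriv X g ∈ A)
    (hf : ∀ v : Module.Dual ℝ V, (fun p => v (f p)) ∈ A) : θ.invariantAlgebra f ≤ A := by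
  refine Algebra.adjoin_le fun g hg => ?_
  induction hg with
  | coefficient v => exact hf v
  | covDeriv X g _ ih => exact hA X g ih

theorem coefficient_mem_invariantAlgebra (θ : CartanConnection (EG := EG) ι B) (f : P → V)
    (v : Module.Dual ℝ V) : (fun p => v (f p)) ∈ θ.invariantAlgebra f :=
  Algebra.subset_adjoin (.coefficient v)

variable [FiniteDimensional ℝ EP]

/-- The generators are stable under covariant derivatives by construction. Stability passes to sums
and products by the rules for derivations, which need differentiability; smoothness of the
coefficients of `f` propagates to the whole algebra. -/
theorem covDeriv_mem_invariantAlgebra (θ : CartanConnection (EG := EG) ι B) {f : P → V}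
    (hf : ∀ v : Module.Dual ℝ V, ContMDiff 𝓘(ℝ, EP) 𝓘(ℝ, ℝ) ∞ (fun p => v (f p)))
    (X : GroupLieAlgebra 𝓘(ℝ, EG) G) {g : P → ℝ} (hg : g ∈ θ.invariantAlgebra f) :
    θ.covDeriv X g ∈ θ.invariantAlgebra f := by
  have hs : ∀ g ∈ θ.invariantAlgebra f, ContMDiff 𝓘(ℝ, EP) 𝓘(ℝ, ℝ) ∞ g :=
    θ.invariantAlgebra_le (A := smoothFunctions EP P) (fun X _ hg => θ.contMDiff_covDeriv X hg) hf
  rw [invariantAlgebra] at hg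
  induction hg using Algebra.adjoin_induction with
  | mem g hg => exact Algebra.subset_adjoin (.covDeriv X g hg)
  | algebraMap c =>
    rw [covDeriv_algebraMap]
    exact zero_mem _
  | add g k hg hk ihg ihk =>
    rw [θ.covDeriv_add X (hs g hg) (hs k hk)]
    exact add_mem ihg ihk
  | mul g k hg hk ihg ihk =>
    rw [θ.covDeriv_mul X (hs g hg) (hs k hk)]
    exact add_mem (mul_mem hg ihk) (mul_mem hk ihg)

variable [CompleteSpace EG] [LieGroup 𝓘(ℝ, EG) ∞ G] [FiniteDimensional ℝ EG]
  (𝒢 : ℤ → Submodule ℝ (GroupLieAlgebra 𝓘(ℝ, EG) G)) [GradedLieAlgebra 𝒢]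

theorem contMDiff_dual_structureFunction (θ : CartanConnection (EG := EG) ι B)
    (u : Module.Dual ℝ (Cochain₂ 𝒢)) :
    ContMDiff 𝓘(ℝ, EP) 𝓘(ℝ, ℝ) ∞ (fun p => u (θ.structureFunction 𝒢 p)) := by
  have : FiniteDimensional ℝ (GroupLieAlgebra 𝓘(ℝ, EG) G) :=
    inferInstanceAs (FiniteDimensional ℝ EG)
  exact dual_comp_cochain_mem 𝒢 (Subalgebra.toSubmodule (smoothFunctions EP P))
    (θ.structureFunction 𝒢)
    (fun _ _ _ _ x y _ _ v => θ.contMDiff_dual_curvatureFunction v x y) u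

end CartanConnection

end Invariants

end CartanGeometry

end

theorem proposition4
    {EG EH EM EP : Type*}
    [NormedAddCommGroup EG] [NormedSpace ℝ EG] [FiniteDimensional ℝ EG] [CompleteSpace EG]
    [NormedAddCommGroup EH] [NormedSpace ℝ EH] [FiniteDimensional ℝ EH]
    [NormedAddCommGroup EM] [NormedSpace ℝ EM] [FiniteDimensional ℝ EM]
    [NormedAddCommGroup EP] [NormedSpace ℝ EP] [FiniteDimensional ℝ EP]
    {G H M P : Type*}
    [Group G] [TopologicalSpace G] [ChartedSpace EG G] [LieGroup 𝓘(ℝ, EG) ∞ G]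
    [Group H] [TopologicalSpace H] [ChartedSpace EH H] [LieGroup 𝓘(ℝ, EH) ∞ H]
    [TopologicalSpace M] [ChartedSpace EM M] [IsManifold 𝓘(ℝ, EM) ∞ M]
    [TopologicalSpace P] [ChartedSpace EP P] [IsManifold 𝓘(ℝ, EP) ∞ P]
    (ι : H →* G) (_hι : CartanGeometry.IsLieSubgroup EG EH ι)
    (B : CartanGeometry.PrincipalBundle EH EM EP H M P)
    (θ : CartanGeometry.CartanConnection (EG := EG) ι B)
    -- the grading of `𝔤`, with `𝔥` the non-negative part
    (𝒢 : ℤ → Submodule ℝ (GroupLieAlgebra 𝓘(ℝ, EG) G)) [GradedLieAlgebra 𝒢]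
    (_h𝔥 : LinearMap.range (CartanGeometry.lieMap (EG := EG) (EH := EH) ι).toLinearMap =
      ⨆ i : {i : ℤ // 0 ≤ i}, 𝒢 i)
    -- the graded subspace `W` of `Hom(⋀² 𝔤₋, 𝔤)`
    (W : Submodule ℝ (CartanGeometry.Cochain₂ 𝒢))
    (_hW : W = ⨆ k : ℤ, W ⊓ CartanGeometry.homogeneous 𝒢 k)
    (hC : ∀ p, θ.structureFunction 𝒢 p ∈ W)
    (_hpos : ∀ p, θ.structureFunction 𝒢 p ∈
      ⨆ k : {k : ℤ // 0 < k}, CartanGeometry.homogeneous 𝒢 k)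
    -- a degree-preserving linear projection of `W` onto `ker ∂ ∩ W`
    (π : W →ₗ[ℝ] ↥(CartanGeometry.kerDifferential 𝒢 ⊓ W))
    (_hπ : ∀ φ : ↥(CartanGeometry.kerDifferential 𝒢 ⊓ W), π ⟨φ.1, φ.2.2⟩ = φ)
    (_hπdeg : ∀ (k : ℤ) (φ : W), φ.1 ∈ CartanGeometry.homogeneous 𝒢 k →
      (π φ).1 ∈ CartanGeometry.homogeneous 𝒢 k) :
    θ.IsFundamentalSystem 𝒢 (fun p => π ⟨θ.structureFunction 𝒢 p, hC p⟩) := by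
  have hCs := CartanGeometry.CartanConnection.contMDiff_dual_structureFunction 𝒢 θ
  have hπs := CartanGeometry.dual_comp_linearMap_comp_mem (θ.structureFunction 𝒢) hC π
    (S := CartanGeometry.smoothFunctions EP P) hCs
  refine le_antisymm ?_ ?_
  -- Coefficients of `π ∘ C` are coefficients of `C`, as a functional on `W` extends to the ambient
  -- space.
  · exact θ.invariantAlgebra_le (fun X g hg => θ.covDeriv_mem_invariantAlgebra hCs X hg)
      (CartanGeometry.dual_comp_linearMap_comp_mem (θ.structureFunction 𝒢) hC π
        (S := θ.invariantAlgebra (θ.structureFunction 𝒢))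
        (θ.coefficient_mem_invariantAlgebra (θ.structureFunction 𝒢)))
  -- The substantial inclusion: the Bianchi induction, run in the algebra `L(π ∘ C)`.
  · have hD := fun X g hg => θ.covDeriv_mem_invariantAlgebra hπs X (g := g) hg
    have : FiniteDimensional ℝ (GroupLieAlgebra 𝓘(ℝ, EG) G) :=
      inferInstanceAs (FiniteDimensional ℝ EG)
    have hhor : ∀ p, ∀ i ≥ 0, ∀ X ∈ 𝒢 i, ∀ Y, θ.curvatureFunction p X Y = 0 := by
      intro p i hi X hX Y
      have hX' : X ∈ LinearMap.range
          (CartanGeometry.lieMap (EG := EG) (EH := EH) ι).toLinearMap := by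
        rw [_h𝔥]
        exact Submodule.mem_iSup_of_mem (p := fun i : {i : ℤ // 0 ≤ i} => 𝒢 i) ⟨i, hi⟩ hX
      obtain ⟨A, rfl⟩ := hX'
      exact θ.curvature_inv_lieMap _hι.contMDiff p A Y
    exact θ.invariantAlgebra_le hD (CartanGeometry.dual_comp_mem_of_bianchi 𝒢
      (fun p X => θ.curvatureFunction p X) θ.curvatureFunction_swap hhor (θ.structureFunction 𝒢)
      (fun _ _ _ => rfl) _ θ.covDeriv hD θ.bianchi W _hW hC _hpos π _hπ _hπdeg
      (θ.coefficient_mem_invariantAlgebra _))
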